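/- **Setting.** A market consists of $n$ customers $\mathcal C$ and $m$ suppliers $\mathcal S$. Each agent $a$ has a discrete choice model $\phi_a$ over the agents of the other side and an outside option $0$: when an assortment $S$ (any subset of the other side) is displayed to $a$, she chooses $o\in S\cup\{0\}$ with probability $\phi_a(o,S)\ge 0$, where $\sum_{o\in S\cup\{0\}}\phi_a(o,S)=1$ and $\phi_a(o,S)=0$ for $o\notin S\cup\{0\}$; choices of different agents are independent. The demand function $f_a(S)=\sum_{b\in S}\phi_a(b,S)$ of every agent is assumed to be monotone and submodular. A *customer-first one-sided adaptive policy* (the class $\mathcal C$-OA) processes all customers one by one and afterwards all suppliers, showing one assortment to each agent; the order and the assortments may be randomized and may depend on all choices observed so far. A match is a customer and a supplier who choose each other, and $\mathbb E[\mathsf M_\pi]$ is the expected number of matches under the policy $\pi$. The *backlog* of a supplier is the set of customers who have chosen her. Let $\mathrm{OPT}_{\mathcal C}$ be the supremum of $\mathbb E[\mathsf M_\pi]$ over all customer-first one-sided adaptive policies, and $\mathrm{OPT}^{\rm bl}_{\mathcal C}$ the supremum over those that show to each supplier only customers of her backlog. **Arbitrary Order Greedy.** Fix any order $i_1,\dots,i_n$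 of the customers and start with empty backlogs $C_j$. For $t=1,\dots,n$, show to $i_t$ a set $S$ maximizing $\sum_{j\in S}\bigl[f_j(C_j\cup\{i_t\})-f_j(C_j)\bigr]\phi_{i_t}(j,S)$ over all $S\subseteq\mathcal S$ (ties are broken arbitrarily), observe her choice $\ell$, and add $i_t$ to $C_\ell$ if $\ell\ne 0$. Finally show to each supplier $j$ exactly her backlog $C_j$. **Theorem.** For every market with monotone submodular demand functions, every order of the customers and every breaking of ties, Arbitrary Order Greedy $\pi$ is a customer-first one-sided adaptive policy that shows to each supplier only customers of her backlog, and $$\mathbb E[\mathsf M_\pi]\ \ge\ \tfrac12\,\mathrm{OPT}^{\rm bl}_{\mathcal C}.$$ If moreover the choice models of the suppliers are weakly substitutable (that is, $\phi_j(o,A)\ge\phi_j(o,A')$ whenever $A\subseteq A'$ and $o\in A\cup\{0\}$), then $$\mathbb E[\mathsf M_\pi]\ \ge\ \tfrac12\,\mathrm{OPT}_{\mathcal C}.$$ The algorithm runs in polynomial time: there are one program and one polynomial $p$ such that in every such market, for every given order, and for every single-agent assortment oracle that returns, for a customer $i$ and weights $\theta\ge0$, a maximizer of $\sum_{j\in S}\theta_j\phi_i(j,S)$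 over $S\subseteq\mathcal S$, the program carries out Arbitrary Order Greedy for this order (and so has the guarantees above), making at most $p(n+m+\tau)$ steps on every sample path, where $\tau$ is the number of steps charged for one oracle call or one look-up of a choice probability and an addition or subtraction of real numbers is one step. The program learns about the choice models only through oracle calls, look-ups and observed choices. The same statements, with the same program and polynomial, hold with the roles of customers and suppliers exchanged, i.e. for the supplier-first one-sided adaptive policies ($\mathcal S$-OA). -/

import Mathlib

open Finset

namespace TwoSided

noncomputable section

/-! ## Choice models and markets -/

/-- A discrete choice model over `k` alternatives plus the outside option `none`:
`prob o S` is the probability of choosing `o` when the assortment `S` is displayed. -/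
structure ChoiceModel (k : ℕ) where
  prob : Option (Fin k) → Finset (Fin k) → ℝ
  prob_nonneg : ∀ o S, 0 ≤ prob o S
  prob_eq_zero : ∀ j S, j ∉ S → prob (some j) S = 0
  sum_prob : ∀ S, ∑ o ∈ insertNone S, prob o S = 1

/-- The demand function: the probability of choosing someone from the assortment. -/
def ChoiceModel.demand {k : ℕ} (φ : ChoiceModel k) (S : Finset (Fin k)) : ℝ :=
  ∑ j ∈ S, φ.prob (some j) S

def ChoiceModel.MonotoneDemand {k : ℕ} (φ : ChoiceModel k) : Prop :=
  ∀ E E' : Finset (Fin k), E ⊆ E' → φ.demand E ≤ φ.demand E'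

def ChoiceModel.SubmodularDemand {k : ℕ} (φ : ChoiceModel k) : Prop :=
  ∀ (e : Fin k) (E E' : Finset (Fin k)), E ⊆ E' → e ∉ E' →
    φ.demand (insert e E') - φ.demand E' ≤ φ.demand (insert e E) - φ.demand E

/-- Weak substitutability: enlarging the assortment never makes an option that was already
available (the outside option included) more likely. -/
def ChoiceModel.WeaklySubstitutable {k : ℕ} (φ : ChoiceModel k) : Prop :=
  ∀ A A' : Finset (Fin k), A ⊆ A' → ∀ o ∈ insertNone A, φ.prob o A' ≤ φ.prob o A

/-- A market with `n` customers and `m` suppliers. -/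
structure Market (n m : ℕ) where
  customer : Fin n → ChoiceModel m
  supplier : Fin m → ChoiceModel n

/-- Every agent has a monotone submodular demand function. -/
def Market.MonotoneSubmodular {n m : ℕ} (M : Market n m) : Prop :=
  (∀ i, (M.customer i).MonotoneDemand ∧ (M.customer i).SubmodularDemand) ∧
  (∀ j, (M.supplier j).MonotoneDemand ∧ (M.supplier j).SubmodularDemand)

/-! ## Policies

One side of the market, with `a` agents, is the *initiating* side; the other one, with `b` agents,
is the *responding* side.  Everything below is stated for choice models `I` of the initiating
agents and `R` of the responding agents, so that it applies to both orders of the sides. -/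

/-- A (randomized, adaptive) policy that processes agents one by one, as a decision tree:
`initiate i S next` displays `S` to the initiating agent `i`, observes the choice `o` (`none` is
the outside option) and continues with `next o`; `respond` does the same for a responding agent;
`mix p π π'` continues with `π` with probability `p` and with `π'` otherwise; `done x` ends, with
output `x`. -/
inductive Policy (a b : ℕ) (α : Type) : Type
  | done (x : α) : Policy a b α
  | initiate (i : Fin a) (S : Finset (Fin b)) (next : Option (Fin b) → Policy a b α) :
      Policy a b α
  | respond (j : Fin b) (C : Finset (Fin a)) (next : Option (Fin a) → Policy a b α) :
      Policy a b α
  | mix (p : unitInterval) (π π' : Policy a b α) : Policy a b α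

namespace Policy

variable {a b : ℕ} {α β : Type}

/-- Sequential composition: each final output `x` is continued with `f x`. -/
def bind : Policy a b α → (α → Policy a b β) → Policy a b β
  | done x, f => f x
  | initiate i S next, f => initiate i S fun o => (next o).bind f
  | respond j C next, f => respond j C fun o => (next o).bind f
  | mix p π π', f => mix p (π.bind f) (π'.bind f)

/-- `P` holds for the output on every sample path. -/
def Always (P : α → Prop) : Policy a b α → Prop
  | done x => P x
  | initiate _ S next => ∀ o ∈ insertNone S, (next o).Always P
  | respond _ C next => ∀ o ∈ insertNone C, (next o).Always P
  | mix _ π π' => π.Always P ∧ π'.Always P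

/-- The policy processes each agent of `U` (initiating side) exactly once, one by one, in an
order and with assortments that may depend on all choices observed so far, and only then each
agent of `V` (responding side). -/
def ProcessesInTurn : Policy a b α → Finset (Fin a) → Finset (Fin b) → Prop
  | done _, U, V => U = ∅ ∧ V = ∅
  | initiate i S next, U, V => i ∈ U ∧ ∀ o ∈ insertNone S, (next o).ProcessesInTurn (U.erase i) V
  | respond j C next, U, V =>
      U = ∅ ∧ j ∈ V ∧ ∀ o ∈ insertNone C, (next o).ProcessesInTurn U (V.erase j)
  | mix _ π π', U, V => π.ProcessesInTurn U V ∧ π'.ProcessesInTurn U V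

/-- The class of one-sided adaptive policies. -/
def OneSidedAdaptive (π : Policy a b α) : Prop := π.ProcessesInTurn univ univ

end Policy

/-- Backlogs: `B j` is the set of initiating agents that have chosen the responding agent `j`.
The update after `i` has chosen `o`. -/
def addToBacklog {a b : ℕ} (B : Fin b → Finset (Fin a)) (i : Fin a) (o : Option (Fin b)) :
    Fin b → Finset (Fin a) :=
  fun j => if o = some j then insert i (B j) else B j

/-- The number of matches, i.e. of pairs that have chosen each other. -/
def matchCount {a b : ℕ} (c : Fin a → Option (Fin b)) (d : Fin b → Option (Fin a)) : ℕ :=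
  #{x : Fin a × Fin b | c x.1 = some x.2 ∧ d x.2 = some x.1}

namespace Policy

variable {a b : ℕ} {α : Type}

/-- With current backlogs `B`: every responding agent is only shown agents of its backlog. -/
def RespectsBacklogs : Policy a b α → (Fin b → Finset (Fin a)) → Prop
  | done _, _ => True
  | initiate i S next, B => ∀ o ∈ insertNone S, (next o).RespectsBacklogs (addToBacklog B i o)
  | respond j C next, B => C ⊆ B j ∧ ∀ o ∈ insertNone C, (next o).RespectsBacklogs B
  | mix _ π π', B => π.RespectsBacklogs B ∧ π'.RespectsBacklogs B

/-- Every responding agent is only shown initiating agents that have chosen it. -/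
def BacklogOnly (π : Policy a b α) : Prop := π.RespectsBacklogs fun _ => ∅

/-- Expected final number of matches, where `c` and `d` are the choices made so far by the
initiating and by the responding agents (`none` also for agents not yet processed). -/
def expectedFrom (I : Fin a → ChoiceModel b) (R : Fin b → ChoiceModel a) :
    Policy a b α → (Fin a → Option (Fin b)) → (Fin b → Option (Fin a)) → ℝ
  | done _, c, d => matchCount c d
  | initiate i S next, c, d =>
      ∑ o ∈ insertNone S, (I i).prob o S * (next o).expectedFrom I R (Function.update c i o) d
  | respond j C next, c, d =>
      ∑ o ∈ insertNone C, (R j).prob o C * (next o).expectedFrom I R c (Function.update d j o)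
  | mix p π π', c, d => p * π.expectedFrom I R c d + (1 - p) * π'.expectedFrom I R c d

/-- The expected number of matches of a policy. -/
def expectedMatches (I : Fin a → ChoiceModel b) (R : Fin b → ChoiceModel a) (π : Policy a b α) :
    ℝ :=
  π.expectedFrom I R (fun _ => none) fun _ => none

end Policy

/-- The optimal value over all one-sided adaptive policies. -/
def optOA {a b : ℕ} (I : Fin a → ChoiceModel b) (R : Fin b → ChoiceModel a) : ℝ :=
  sSup {v | ∃ π : Policy a b Unit, π.OneSidedAdaptive ∧ v = π.expectedMatches I R}

/-- The optimal value over the one-sided adaptive policies that show to every responding agent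
only initiating agents that have chosen it. -/
def optBacklogOA {a b : ℕ} (I : Fin a → ChoiceModel b) (R : Fin b → ChoiceModel a) : ℝ :=
  sSup {v | ∃ π : Policy a b Unit,
    π.OneSidedAdaptive ∧ π.BacklogOnly ∧ v = π.expectedMatches I R}

/-! Both optimal values are suprema of nonempty bounded sets. -/

theorem Policy.expectedFrom_le {a b : ℕ} {α : Type} (I : Fin a → ChoiceModel b)
    (R : Fin b → ChoiceModel a) (π : Policy a b α) :
    ∀ c d, π.expectedFrom I R c d ≤ (a * b : ℕ) := by
  induction π with
  | done x =>
      intro c d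
      simp only [Policy.expectedFrom, matchCount]
      exact_mod_cast (card_le_univ _).trans (by simp)
  | initiate i S next ih =>
      intro c d
      calc _ ≤ ∑ o ∈ insertNone S, (I i).prob o S * ((a * b : ℕ) : ℝ) :=
            sum_le_sum fun o _ => mul_le_mul_of_nonneg_left (ih o _ _) ((I i).prob_nonneg o S)
        _ = _ := by rw [← sum_mul, (I i).sum_prob, one_mul]
  | respond j C next ih =>
      intro c d
      calc _ ≤ ∑ o ∈ insertNone C, (R j).prob o C * ((a * b : ℕ) : ℝ) :=
            sum_le_sum fun o _ => mul_le_mul_of_nonneg_left (ih o _ _) ((R j).prob_nonneg o C)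
        _ = _ := by rw [← sum_mul, (R j).sum_prob, one_mul]
  | mix p π π' ih ih' =>
      intro c d
      have h1 := mul_le_mul_of_nonneg_left (ih c d) p.2.1
      have h2 := mul_le_mul_of_nonneg_left (ih' c d) (sub_nonneg.2 p.2.2)
      simp only [Policy.expectedFrom]
      linarith

theorem bddAbove_expectedMatches {a b : ℕ} (I : Fin a → ChoiceModel b)
    (R : Fin b → ChoiceModel a) :
    BddAbove {v | ∃ π : Policy a b Unit, π.OneSidedAdaptive ∧ v = π.expectedMatches I R} :=
  ⟨((a * b : ℕ) : ℝ), by rintro _ ⟨π, -, rfl⟩; exact π.expectedFrom_le I R _ _⟩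

theorem exists_backlogOnly (a b : ℕ) :
    ∃ π : Policy a b Unit, π.OneSidedAdaptive ∧ π.BacklogOnly := by
  have h1 : ∀ V : Finset (Fin b), ∃ π : Policy a b Unit,
      π.ProcessesInTurn ∅ V ∧ ∀ B, π.RespectsBacklogs B := by
    intro V
    induction V using Finset.induction_on with
    | empty => exact ⟨.done (), by simp [Policy.ProcessesInTurn], fun _ => trivial⟩
    | insert j V hj ih =>
      obtain ⟨π, h, h'⟩ := ih
      refine ⟨.respond j ∅ fun _ => π, ⟨rfl, by simp, fun o _ => ?_⟩, fun B => ⟨by simp, ?_⟩⟩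
      · rw [erase_insert hj]; exact h
      · exact fun o _ => h' B
  have h2 : ∀ U : Finset (Fin a), ∃ π : Policy a b Unit,
      π.ProcessesInTurn U univ ∧ ∀ B, π.RespectsBacklogs B := by
    intro U
    induction U using Finset.induction_on with
    | empty => exact h1 univ
    | insert i U hi ih =>
      obtain ⟨π, h, h'⟩ := ih
      refine ⟨.initiate i ∅ fun _ => π, ⟨by simp, fun o _ => ?_⟩, fun B o _ => h' _⟩
      rw [erase_insert hi]; exact h
  obtain ⟨π, h, h'⟩ := h2 univ
  exact ⟨π, h, h' _⟩

/-! ## The greedy algorithm -/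

/-- `S` solves the unconstrained single-agent assortment optimization problem for the choice model
`φ` and the weights `θ`. -/
def IsOptimalAssortment {k : ℕ} (φ : ChoiceModel k) (θ : Fin k → ℝ) (S : Finset (Fin k)) : Prop :=
  ∀ S' : Finset (Fin k), ∑ j ∈ S', θ j * φ.prob (some j) S' ≤ ∑ j ∈ S, θ j * φ.prob (some j) S

/-- The increase of the demand of the responding agent `j` when `i` joins its backlog. -/
def marginal {a b : ℕ} (R : Fin b → ChoiceModel a) (B : Fin b → Finset (Fin a)) (i : Fin a)
    (j : Fin b) : ℝ :=
  (R j).demand (insert i (B j)) - (R j).demand (B j)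

/-- Greedy behaviour from the current backlogs `B` on, when the initiating agents of the list are
still to be processed in this order, and then the responding agents in `V`: an initiating agent is
shown any assortment maximizing the expected marginal demand, a responding agent its backlog. -/
def Policy.GreedyFrom {a b : ℕ} {α : Type} (I : Fin a → ChoiceModel b) (R : Fin b → ChoiceModel a) :
    Policy a b α → List (Fin a) → Finset (Fin b) → (Fin b → Finset (Fin a)) → Prop
  | .done _, l, V, _ => l = [] ∧ V = ∅
  | .initiate i S next, l, V, B =>
      l.head? = some i ∧ IsOptimalAssortment (I i) (marginal R B i) S ∧
        ∀ o ∈ insertNone S, (next o).GreedyFrom I R l.tail V (addToBacklog B i o)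
  | .respond j C next, l, V, B =>
      l = [] ∧ j ∈ V ∧ C = B j ∧
        ∀ o ∈ insertNone C, (next o).GreedyFrom I R l (V.erase j) B
  | .mix _ π π', l, V, B => π.GreedyFrom I R l V B ∧ π'.GreedyFrom I R l V B

/-- The policy is an execution of the Arbitrary Order Greedy algorithm for the order
`σ 0, σ 1, …, σ (a - 1)` of the initiating agents (ties are broken arbitrarily). -/
def Policy.IsArbitraryOrderGreedy {a b : ℕ} {α : Type} (I : Fin a → ChoiceModel b)
    (R : Fin b → ChoiceModel a) (σ : Equiv.Perm (Fin a)) (π : Policy a b α) : Prop :=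
  π.GreedyFrom I R (List.ofFn σ) univ fun _ => ∅

/-- `π` is a one-sided adaptive policy, it shows to the responding agents only their backlogs, and
its expected number of matches is at least half of the optimum over all policies of this kind; it
is at least half of the optimum over all one-sided adaptive policies, whatever these show to the
responding agents, if the latter have weakly substitutable choice models. -/
def Policy.HalfApproximates {a b : ℕ} {α : Type} (I : Fin a → ChoiceModel b)
    (R : Fin b → ChoiceModel a) (π : Policy a b α) : Prop :=
  π.OneSidedAdaptive ∧ π.BacklogOnly ∧
    1 / 2 * optBacklogOA I R ≤ π.expectedMatches I R ∧
    ((∀ j, (R j).WeaklySubstitutable) → 1 / 2 * optOA I R ≤ π.expectedMatches I R)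

/-! ## Programs and their running time

A small imperative language with natural-number variables, two-dimensional arrays of natural
numbers and arrays of real numbers.  Arithmetic is limited to sums and (truncated, on `ℕ`)
differences; the only loops are counted loops.  The row `r` of the array `k` encodes the set of the
indices of its nonzero entries. -/

/-- Expressions with values in `ℕ`. -/
inductive NatExpr : Type
  | lit (c : ℕ)
  | var (x : ℕ)
  | entry (k : ℕ) (row col : NatExpr)
  | add (e e' : NatExpr)
  | sub (e e' : NatExpr)

/-- Expressions with values in `ℝ`. -/
inductive RealExpr : Type
  | entry (k : ℕ) (pos : NatExpr)
  | add (e e' : RealExpr)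
  | sub (e e' : RealExpr)

/-- Programs. -/
inductive Program : Type
  | skip
  | seq (P Q : Program)
  /-- `if e ≠ 0 then P else Q` -/
  | ifNonzero (e : NatExpr) (P Q : Program)
  /-- `for x = 0, …, e - 1 do P`, where `e` is evaluated once, before the loop -/
  | loop (x : ℕ) (e : NatExpr) (P : Program)
  | setVar (x : ℕ) (e : NatExpr)
  | setEntry (k : ℕ) (row col e : NatExpr)
  | setReal (k : ℕ) (pos : NatExpr) (e : RealExpr)
  /-- look up the probability that the responding agent `j` chooses `o` (`0` is the outside option,
  `i + 1` is agent `i`) from the set in row `row` of array `k`, and store it in the real array `t`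
  at `pos` -/
  | lookup (j o : NatExpr) (k : ℕ) (row : NatExpr) (t : ℕ) (pos : NatExpr)
  /-- call the single-agent assortment oracle for the initiating agent `i`, with the weights in
  the real array `t`, and store the answer in row `row` of array `k` -/
  | optimize (i : NatExpr) (t : ℕ) (k : ℕ) (row : NatExpr)
  /-- display the set in row `row` of array `k` to the initiating agent `i`, and store the choice
  in `x` (`0` is the outside option, `j + 1` is agent `j`) -/
  | initiate (i : NatExpr) (k : ℕ) (row : NatExpr) (x : ℕ)
  /-- the same for the responding agent `j` -/
  | respond (j : NatExpr) (k : ℕ) (row : NatExpr) (x : ℕ)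

/-- The memory, together with the number of steps made so far. -/
structure Store where
  var : ℕ → ℕ
  entry : ℕ → ℕ → ℕ → ℕ
  real : ℕ → ℕ → ℝ
  time : ℕ

def NatExpr.eval (s : Store) : NatExpr → ℕ
  | lit c => c
  | var x => s.var x
  | entry k row col => s.entry k (row.eval s) (col.eval s)
  | add e e' => e.eval s + e'.eval s
  | sub e e' => e.eval s - e'.eval s

/-- Number of steps of the evaluation. -/
def NatExpr.cost : NatExpr → ℕ
  | lit _ => 1
  | var _ => 1
  | entry _ row col => row.cost + col.cost + 1
  | add e e' => e.cost + e'.cost + 1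
  | sub e e' => e.cost + e'.cost + 1

def RealExpr.eval (s : Store) : RealExpr → ℝ
  | entry k pos => s.real k (pos.eval s)
  | add e e' => e.eval s + e'.eval s
  | sub e e' => e.eval s - e'.eval s

/-- Number of steps of the evaluation. -/
def RealExpr.cost : RealExpr → ℕ
  | entry _ pos => pos.cost + 1
  | add e e' => e.cost + e'.cost + 1
  | sub e e' => e.cost + e'.cost + 1

namespace Store

def tick (s : Store) (t : ℕ) : Store := { s with time := s.time + t }

def setVar (s : Store) (x v : ℕ) : Store := { s with var := Function.update s.var x v }

def setRow (s : Store) (k r : ℕ) (f : ℕ → ℕ) : Store :=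
  { s with entry := Function.update s.entry k (Function.update (s.entry k) r f) }

def setEntry (s : Store) (k r c v : ℕ) : Store :=
  s.setRow k r (Function.update (s.entry k r) c v)

def setReal (s : Store) (k r : ℕ) (v : ℝ) : Store :=
  { s with real := Function.update s.real k (Function.update (s.real k) r v) }

/-- The subset of `Fin l` encoded by a row. -/
def rowSet (s : Store) (l k r : ℕ) : Finset (Fin l) := {x | s.entry k r x ≠ 0}

end Store

/-- The row that encodes a set. -/
def encodeSet {l : ℕ} (A : Finset (Fin l)) (x : ℕ) : ℕ := if ∃ h : x < l, ⟨x, h⟩ ∈ A then 1 else 0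

/-- The code of a choice. -/
def encodeChoice {l : ℕ} : Option (Fin l) → ℕ
  | none => 0
  | some x => x + 1

/-- The value of `f` at the choice with code `o`, and `0` if `o` is not the code of a choice. -/
def atChoice {l : ℕ} (f : Option (Fin l) → ℝ) : ℕ → ℝ
  | 0 => f none
  | x + 1 => if h : x < l then f (some ⟨x, h⟩) else 0

/-- `body 0`, …, `body (N - 1)`, one after the other. -/
def iterate {a b : ℕ} (body : ℕ → Store → Policy a b Store) : ℕ → Store → Policy a b Store
  | 0, s => .done s
  | N + 1, s => (iterate body N s).bind (body N)

/-- A single-agent assortment optimization oracle for the initiating agents: given an agent and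
weights, it returns an assortment. -/
abbrev Oracle (a b : ℕ) : Type := Fin a → (Fin b → ℝ) → Finset (Fin b)

/-- The oracle solves the problem of every agent for all nonnegative weights. -/
def Oracle.Correct {a b : ℕ} (O : Oracle a b) (I : Fin a → ChoiceModel b) : Prop :=
  ∀ i (θ : Fin b → ℝ), (∀ j, 0 ≤ θ j) → IsOptimalAssortment (I i) θ (O i θ)

/-- The policy carried out by a program, on a market whose responding agents have the choice models
`R`, with the oracle `O`, where each oracle call and each look-up of a choice probability takes `τ`
steps.  The program learns about the choice models only through look-ups, oracle calls and observed
choices.  Reading or writing a set or a vector of weights takes `a + b` steps.  Instructions that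
refer to agents that do not exist have no effect. -/
def Program.exec {a b : ℕ} (R : Fin b → ChoiceModel a) (O : Oracle a b) (τ : ℕ) :
    Program → Store → Policy a b Store
  | skip, s => .done (s.tick 1)
  | seq P Q, s => (P.exec R O τ s).bind (Q.exec R O τ)
  | ifNonzero e P Q, s =>
      if e.eval s ≠ 0 then P.exec R O τ (s.tick (e.cost + 1))
      else Q.exec R O τ (s.tick (e.cost + 1))
  | loop x e P, s =>
      iterate (fun t s' => P.exec R O τ ((s'.setVar x t).tick 1)) (e.eval s)
        (s.tick (e.cost + 1))
  | setVar x e, s => .done ((s.setVar x (e.eval s)).tick (e.cost + 1))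
  | setEntry k row col e, s =>
      .done ((s.setEntry k (row.eval s) (col.eval s) (e.eval s)).tick
        (row.cost + col.cost + e.cost + 1))
  | setReal k pos e, s =>
      .done ((s.setReal k (pos.eval s) (e.eval s)).tick (pos.cost + e.cost + 1))
  | lookup j o k row t pos, s =>
      let s' := s.tick (j.cost + o.cost + row.cost + pos.cost + a + b + τ + 1)
      if h : j.eval s < b then
        .done (s'.setReal t (pos.eval s)
          (atChoice (fun c => (R ⟨j.eval s, h⟩).prob c (s.rowSet a k (row.eval s))) (o.eval s)))
      else .done s'
  | optimize i t k row, s =>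
      let s' := s.tick (i.cost + row.cost + a + b + τ + 1)
      if h : i.eval s < a then
        .done (s'.setRow k (row.eval s) (encodeSet (O ⟨i.eval s, h⟩ fun j => s.real t j)))
      else .done s'
  | initiate i k row x, s =>
      let s' := s.tick (i.cost + row.cost + a + b + 1)
      if h : i.eval s < a then
        .initiate ⟨i.eval s, h⟩ (s.rowSet b k (row.eval s)) fun c =>
          .done (s'.setVar x (encodeChoice c))
      else .done s'
  | respond j k row x, s =>
      let s' := s.tick (j.cost + row.cost + a + b + 1)
      if h : j.eval s < b then
        .respond ⟨j.eval s, h⟩ (s.rowSet a k (row.eval s)) fun c =>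
          .done (s'.setVar x (encodeChoice c))
      else .done s'

/-- The input: variables `0` and `1` hold the numbers of initiating and of responding agents, and
row `0` of array `0` holds the order `σ 0, σ 1, …` of the initiating agents; everything else is
`0`. -/
def initialStore {a : ℕ} (b : ℕ) (σ : Equiv.Perm (Fin a)) : Store where
  var x := if x = 0 then a else if x = 1 then b else 0
  entry k row t := if h : k = 0 ∧ row = 0 ∧ t < a then (σ ⟨t, h.2.2⟩ : ℕ) else 0
  real _ _ := 0
  time := 0

/-- The policy carried out by a program on its input. -/
def Program.run {a b : ℕ} (P : Program) (R : Fin b → ChoiceModel a) (O : Oracle a b) (τ : ℕ)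
    (σ : Equiv.Perm (Fin a)) : Policy a b Store :=
  P.exec R O τ (initialStore b σ)

end

end TwoSided

open TwoSided

namespace TwoSided

section HalfApproximation

variable {k a b : ℕ} {α : Type}

/-! ## Submodular demand functions -/

/-! The proof is a charging argument in the style of linear programming duality. Fix any sets `G j`
and numbers `u i` such that no assortment shown to `i` has expected marginal demand above `u i` when
the backlogs are `G`. Then every admissible competing policy has value at most `∑ j, f_j (G j) + ∑
i, u i` (`expectedMatches_le_of_boundsMarginal`). Indeed, given the choices of the initiating
agents, the responding agents contribute at most the demands of their final backlogs: by
monotonicity if only backlogs are shown, and otherwise by weak substitutability. Submodularity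
bounds these demands by those of `G` plus one marginal at `G` for every initiating agent that has
made a choice. Averaged over the choice of `i`, this marginal is at most `u i`.

The bound is applied on every sample path of the greedy policy, with `G` its final backlogs and `u
i` the expected marginal of the assortment that it showed to `i`. This `u i` is maximal for the
backlogs of that moment and remains an upper bound later, since marginals shrink as backlogs grow
(`BoundsMarginal.mono`). In expectation the `u i` add up to the total demand of the final backlogs,
because the increments telescope, and that demand is the expected number of greedy matches. Hence
the competitor has at most twice the greedy value (`GreedyFrom.add_sum_demand_le`).

For the running time, `GreedyUntil` serves as the postcondition of a Hoare-style calculus: loop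
invariants show that the tree executed by `greedyProgram` is a greedy policy, and simultaneously
count its steps. -/

theorem ChoiceModel.demand_empty (φ : ChoiceModel k) : φ.demand ∅ = 0 := by
  simp [ChoiceModel.demand]

theorem ChoiceModel.demand_eq_sum_univ (φ : ChoiceModel k) (S : Finset (Fin k)) :
    φ.demand S = ∑ j, φ.prob (some j) S :=
  sum_subset (subset_univ S) fun j _ hj => φ.prob_eq_zero j S hj

/-- Submodularity is assumed only for `e ∉ E'`. For `e ∈ E'` the left side vanishes and monotonicity
makes the right side nonnegative. -/
theorem ChoiceModel.demand_insert_sub_antitone {φ : ChoiceModel k} (hm : φ.MonotoneDemand)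
    (hs : φ.SubmodularDemand) (e : Fin k) {E E' : Finset (Fin k)} (h : E ⊆ E') :
    φ.demand (insert e E') - φ.demand E' ≤ φ.demand (insert e E) - φ.demand E := by
  by_cases he : e ∈ E'
  · rw [insert_eq_of_mem he, sub_self]
    exact sub_nonneg.2 (hm _ _ (subset_insert e E))
  · exact hs e E E' h he

/-- The elements of `A` are added to `G` one at a time; each increment is at most the increment at
`G` itself. Elements already in `G` contribute zero. -/
theorem ChoiceModel.demand_le_add_sum {φ : ChoiceModel k} (hm : φ.MonotoneDemand)
    (hs : φ.SubmodularDemand) (A G : Finset (Fin k)) :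
    φ.demand A ≤ φ.demand G + ∑ e ∈ A, (φ.demand (insert e G) - φ.demand G) := by
  refine (hm A (A ∪ G) subset_union_left).trans ?_
  induction A using Finset.induction_on with
  | empty => simp
  | insert e A he ih =>
    have h := demand_insert_sub_antitone hm hs e (subset_union_right : G ⊆ A ∪ G)
    rw [sum_insert he, insert_union]
    linarith

/-- Only agents in the backlog `B` can produce a match. Removing the others from the assortment `C`
does not lower the probability of any remaining one, so displaying agents outside the backlog brings
no gain. -/
theorem ChoiceModel.sum_prob_some_inter_le {φ : ChoiceModel k} (hm : φ.MonotoneDemand)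
    (hw : φ.WeaklySubstitutable) (C B : Finset (Fin k)) :
    ∑ i ∈ C ∩ B, φ.prob (some i) C ≤ φ.demand B :=
  (sum_le_sum fun i hi => hw (C ∩ B) C inter_subset_left (some i) (by simpa using hi)).trans
    (hm (C ∩ B) B inter_subset_right)

theorem ChoiceModel.sum_prob_mul_add (φ : ChoiceModel k) (S : Finset (Fin k))
    (g : Option (Fin k) → ℝ) (x : ℝ) :
    ∑ o ∈ insertNone S, φ.prob o S * (g o + x) = ∑ o ∈ insertNone S, φ.prob o S * g o + x := by
  simp only [mul_add, sum_add_distrib, ← sum_mul, φ.sum_prob, one_mul]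

theorem ChoiceModel.sum_prob_mul_elim (φ : ChoiceModel k) (S : Finset (Fin k))
    (g : Fin k → ℝ) :
    ∑ o ∈ insertNone S, φ.prob o S * o.elim 0 g = ∑ j ∈ S, g j * φ.prob (some j) S := by
  simp [insertNone, mul_comm]

/-! ## Backlogs and matches -/

/-- The backlogs that result from the choices `c` of the initiating agents. -/
def backlog (c : Fin a → Option (Fin b)) (j : Fin b) : Finset (Fin a) := {i | c i = some j}

theorem mem_backlog {c : Fin a → Option (Fin b)} {j : Fin b} {i : Fin a} :
    i ∈ backlog c j ↔ c i = some j := by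
  simp [backlog]

theorem backlog_none : backlog (fun _ : Fin a => (none : Option (Fin b))) = fun _ => ∅ := by
  funext j
  simp [backlog]

/-- Links the incremental backlogs in the definitions of policies to those read off from the
choices. Without `c i = none`, the update would remove `i` from its former backlog. -/
theorem addToBacklog_backlog {c : Fin a → Option (Fin b)} {i : Fin a} (hi : c i = none)
    (o : Option (Fin b)) : addToBacklog (backlog c) i o = backlog (Function.update c i o) := by
  funext j
  ext i'
  rw [mem_backlog, addToBacklog]
  by_cases h : i' = i
  · subst h
    split_ifs with ho <;> simp [mem_backlog, hi, ho]
  · split_ifs with ho <;> simp [mem_backlog, h]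

theorem subset_addToBacklog (B : Fin b → Finset (Fin a)) (i : Fin a) (o : Option (Fin b))
    (j : Fin b) : B j ⊆ addToBacklog B i o j := by
  unfold addToBacklog
  split_ifs
  · exact subset_insert i (B j)
  · exact Subset.rfl

theorem matchCount_none (c : Fin a → Option (Fin b)) : matchCount c (fun _ => none) = 0 := by
  simp [matchCount]

theorem matchCount_update {c : Fin a → Option (Fin b)} {d : Fin b → Option (Fin a)} {j : Fin b}
    (hj : d j = none) (o : Option (Fin a)) :
    (matchCount c (Function.update d j o) : ℝ) =
      o.elim 0 (fun i => if c i = some j then 1 else 0) + matchCount c d := by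
  cases o with
  | none => rw [← hj, Function.update_eq_self]; simp [hj]
  | some i =>
    simp only [matchCount, Option.elim]
    by_cases hc : c i = some j
    · have : ({x : Fin a × Fin b | c x.1 = some x.2 ∧
          Function.update d j (some i) x.2 = some x.1} : Finset (Fin a × Fin b)) =
          insert (i, j) ({x : Fin a × Fin b | c x.1 = some x.2 ∧ d x.2 = some x.1} :
            Finset (Fin a × Fin b)) := by
        ext ⟨x, y⟩
        by_cases hy : y = j
        · subst hy
          simp only [mem_filter, mem_univ, true_and, Function.update_self, mem_insert, hj,
            Prod.mk.injEq, and_true, Option.some.injEq]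
          constructor
          · rintro ⟨-, h⟩; exact .inl h.symm
          · rintro (h | h)
            · exact ⟨h ▸ hc, h.symm⟩
            · simp at h
        · simp [hy]
      rw [this, card_insert_of_notMem (by simp [hj])]
      simp [hc, add_comm]
    · have : ({x : Fin a × Fin b | c x.1 = some x.2 ∧
          Function.update d j (some i) x.2 = some x.1} : Finset (Fin a × Fin b)) =
          ({x : Fin a × Fin b | c x.1 = some x.2 ∧ d x.2 = some x.1} :
            Finset (Fin a × Fin b)) := by
        ext ⟨x, y⟩
        by_cases hy : y = j
        · subst hy
          simp only [mem_filter, mem_univ, true_and, Function.update_self, hj,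
            Option.some.injEq]
          constructor
          · rintro ⟨h, rfl⟩; exact absurd h hc
          · rintro ⟨-, h⟩; simp at h
        · simp [hy]
      rw [this]
      simp [hc]

theorem sum_prob_mul_matchCount (φ : ChoiceModel a) (C : Finset (Fin a))
    {c : Fin a → Option (Fin b)} {d : Fin b → Option (Fin a)} {j : Fin b} (hj : d j = none) :
    ∑ o ∈ insertNone C, φ.prob o C * (matchCount c (Function.update d j o) : ℝ) =
      matchCount c d + ∑ i ∈ C ∩ backlog c j, φ.prob (some i) C := by
  simp only [matchCount_update hj, φ.sum_prob_mul_add, φ.sum_prob_mul_elim]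
  rw [add_comm, ← filter_mem_eq_inter, sum_filter]
  simp [mem_backlog]

/-- The total demand is the potential of the greedy analysis: a choice changes it by exactly the
marginal that greedy optimizes, and the outside option by zero. -/
theorem sum_demand_addToBacklog (R : Fin b → ChoiceModel a) (B : Fin b → Finset (Fin a))
    (i : Fin a) (o : Option (Fin b)) :
    ∑ j, (R j).demand (addToBacklog B i o j) =
      o.elim 0 (marginal R B i) + ∑ j, (R j).demand (B j) := by
  rw [← sub_eq_iff_eq_add, ← sum_sub_distrib]
  cases o with
  | none => simp [addToBacklog]
  | some l =>
    rw [sum_eq_single l]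
    · simp [addToBacklog, marginal]
    · intro j _ hj
      simp [addToBacklog, Ne.symm hj]
    · simp

/-- Joint monotonicity and submodularity of the demand functions of the responding agents. -/
def MonotoneSubmodularDemands (R : Fin b → ChoiceModel a) : Prop :=
  ∀ j, (R j).MonotoneDemand ∧ (R j).SubmodularDemand

theorem marginal_nonneg {R : Fin b → ChoiceModel a} (hR : MonotoneSubmodularDemands R)
    (B : Fin b → Finset (Fin a)) (i : Fin a) (j : Fin b) : 0 ≤ marginal R B i j :=
  sub_nonneg.2 ((hR j).1 _ _ (subset_insert i (B j)))

/-- After exchanging the two sums, each `i` is counted once, since it lies in at most one backlog.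
-/
theorem sum_demand_backlog_le {R : Fin b → ChoiceModel a} (hR : MonotoneSubmodularDemands R)
    (c : Fin a → Option (Fin b)) (G : Fin b → Finset (Fin a)) :
    ∑ j, (R j).demand (backlog c j) ≤
      ∑ j, (R j).demand (G j) + ∑ i, (c i).elim 0 (marginal R G i) := by
  calc _ ≤ ∑ j, ((R j).demand (G j) + ∑ i ∈ backlog c j, marginal R G i j) :=
        sum_le_sum fun j _ => ChoiceModel.demand_le_add_sum (hR j).1 (hR j).2 _ _
    _ = _ := by
        rw [sum_add_distrib]
        congr 1
        simp only [backlog, sum_filter]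
        rw [sum_comm]
        refine sum_congr rfl fun i _ => ?_
        cases h : c i <;> simp

/-- `u` bounds the expected marginal demand, at the backlogs `B`, of every assortment that is shown
to `i`. -/
def BoundsMarginal (I : Fin a → ChoiceModel b) (R : Fin b → ChoiceModel a)
    (B : Fin b → Finset (Fin a)) (i : Fin a) (u : ℝ) : Prop :=
  ∀ S : Finset (Fin b), ∑ j ∈ S, marginal R B i j * (I i).prob (some j) S ≤ u

theorem BoundsMarginal.mono {I : Fin a → ChoiceModel b} {R : Fin b → ChoiceModel a}
    (hR : MonotoneSubmodularDemands R) {B B' : Fin b → Finset (Fin a)} {i : Fin a} {u : ℝ}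
    (h : BoundsMarginal I R B i u) (hB : ∀ j, B j ⊆ B' j) : BoundsMarginal I R B' i u :=
  fun S => (sum_le_sum fun j _ => mul_le_mul_of_nonneg_right
    (ChoiceModel.demand_insert_sub_antitone (hR j).1 (hR j).2 i (hB j))
    ((I i).prob_nonneg _ S)).trans (h S)

/-! ## Upper bound for arbitrary policies -/

namespace Policy

theorem expectedFrom_respond_le {I : Fin a → ChoiceModel b} {R : Fin b → ChoiceModel a}
    (hR : ∀ j, (R j).MonotoneDemand) (c : Fin a → Option (Fin b)) (π : Policy a b α) :
    ∀ (V : Finset (Fin b)) (d : Fin b → Option (Fin a)), π.ProcessesInTurn ∅ V →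
      (∀ j ∈ V, d j = none) →
      (π.RespectsBacklogs (backlog c) ∨ ∀ j, (R j).WeaklySubstitutable) →
      π.expectedFrom I R c d ≤ matchCount c d + ∑ j ∈ V, (R j).demand (backlog c j) := by
  induction π with
  | done x =>
    rintro V d ⟨-, rfl⟩ - -
    simp [expectedFrom]
  | initiate i S next ih =>
    rintro V d ⟨h, -⟩
    simp at h
  | respond j C next ih =>
    rintro V d ⟨-, hj, hp⟩ hd hb
    have h1 : ∀ o ∈ insertNone C, (next o).expectedFrom I R c (Function.update d j o) ≤
        matchCount c (Function.update d j o) +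
          ∑ j ∈ V.erase j, (R j).demand (backlog c j) := by
      refine fun o ho => ih o _ _ (hp o ho) (fun j' hj' => ?_) (hb.imp_left fun h => h.2 o ho)
      rw [Function.update_of_ne (ne_of_mem_erase hj')]
      exact hd j' (mem_of_mem_erase hj')
    -- The two classes of competitors are treated differently only here.
    have h2 : ∑ i ∈ C ∩ backlog c j, (R j).prob (some i) C ≤ (R j).demand (backlog c j) := by
      rcases hb with h | h
      · rw [inter_eq_left.2 h.1]
        exact hR j _ _ h.1
      · exact ChoiceModel.sum_prob_some_inter_le (hR j) (h j) _ _
    calc _ ≤ ∑ o ∈ insertNone C, (R j).prob o C * (matchCount c (Function.update d j o) +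
            ∑ j ∈ V.erase j, (R j).demand (backlog c j)) :=
          sum_le_sum fun o ho => mul_le_mul_of_nonneg_left (h1 o ho) ((R j).prob_nonneg o C)
      _ ≤ _ := by
          rw [ChoiceModel.sum_prob_mul_add, sum_prob_mul_matchCount _ _ (hd j hj),
            ← add_sum_erase V _ hj]
          linarith
  | mix p π π' ih ih' =>
    rintro V d ⟨h, h'⟩ hd hb
    have h1 := mul_le_mul_of_nonneg_left (ih V d h hd (hb.imp_left And.left)) p.2.1
    have h2 := mul_le_mul_of_nonneg_left (ih' V d h' hd (hb.imp_left And.right))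
      (sub_nonneg.2 p.2.2)
    simp only [expectedFrom]
    linarith

/-- `G` and `u` are fixed independently of `π`. Agents still to be processed are charged `u i`, the
others the marginal at `G` of their actual choice. Processing `i` replaces the first charge by the
second, which in expectation is no larger. -/
theorem expectedFrom_le_of_boundsMarginal {I : Fin a → ChoiceModel b}
    {R : Fin b → ChoiceModel a} (hR : MonotoneSubmodularDemands R)
    {G : Fin b → Finset (Fin a)} {u : Fin a → ℝ} (hu : ∀ i, BoundsMarginal I R G i (u i))
    (π : Policy a b α) :
    ∀ (U : Finset (Fin a)) (c : Fin a → Option (Fin b)), π.ProcessesInTurn U univ →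
      (∀ i ∈ U, c i = none) →
      (π.RespectsBacklogs (backlog c) ∨ ∀ j, (R j).WeaklySubstitutable) →
      π.expectedFrom I R c (fun _ => none) ≤ ∑ j, (R j).demand (G j) +
        ∑ i, if i ∈ U then u i else (c i).elim 0 (marginal R G i) := by
  have key : ∀ (π : Policy a b α) (c : Fin a → Option (Fin b)), π.ProcessesInTurn ∅ univ →
      (π.RespectsBacklogs (backlog c) ∨ ∀ j, (R j).WeaklySubstitutable) →
      π.expectedFrom I R c (fun _ => none) ≤ ∑ j, (R j).demand (G j) +
        ∑ i, if i ∈ (∅ : Finset (Fin a)) then u i else (c i).elim 0 (marginal R G i) := by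
    intro π c hp hb
    have h := expectedFrom_respond_le (I := I) (fun j => (hR j).1) c π univ (fun _ => none) hp
      (fun _ _ => rfl) hb
    rw [matchCount_none, Nat.cast_zero, zero_add] at h
    simpa using h.trans (sum_demand_backlog_le hR c G)
  induction π with
  | done x =>
    intro U c hp _ hb
    obtain rfl := hp.1
    exact key _ c hp hb
  | respond j C next ih =>
    intro U c hp _ hb
    obtain rfl := hp.1
    exact key _ c hp hb
  | initiate i S next ih =>
    rintro U c ⟨hi, hp⟩ hc hb
    -- The charge of `i` is split off; everything else on the right is independent of `o` and passes
    -- through the expectation unchanged.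
    have h1 : ∀ o ∈ insertNone S, (next o).expectedFrom I R (Function.update c i o)
        (fun _ => none) ≤ o.elim 0 (marginal R G i) + (∑ j, (R j).demand (G j) +
          ∑ x ∈ univ.erase i, if x ∈ U then u x else (c x).elim 0 (marginal R G x)) := by
      intro o ho
      refine (ih o (U.erase i) (Function.update c i o) (hp o ho) (fun x hx => ?_)
        (hb.imp_left fun h => ?_)).trans ?_
      · rw [Function.update_of_ne (ne_of_mem_erase hx)]
        exact hc x (mem_of_mem_erase hx)
      · rw [← addToBacklog_backlog (hc i hi)]
        exact h o ho
      · rw [← add_sum_erase univ _ (mem_univ i)]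
        have : ∑ x ∈ univ.erase i, (if x ∈ U.erase i then u x else
              (Function.update c i o x).elim 0 (marginal R G x)) =
            ∑ x ∈ univ.erase i, if x ∈ U then u x else (c x).elim 0 (marginal R G x) := by
          refine sum_congr rfl fun x hx => ?_
          simp [ne_of_mem_erase hx]
        rw [this]
        simp
        linarith
    calc _ ≤ ∑ o ∈ insertNone S, (I i).prob o S * (o.elim 0 (marginal R G i) +
            (∑ j, (R j).demand (G j) + ∑ x ∈ univ.erase i,
              if x ∈ U then u x else (c x).elim 0 (marginal R G x))) :=
          sum_le_sum fun o ho => mul_le_mul_of_nonneg_left (h1 o ho) ((I i).prob_nonneg o S)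
      _ ≤ _ := by
          rw [ChoiceModel.sum_prob_mul_add, ChoiceModel.sum_prob_mul_elim,
            ← add_sum_erase univ (fun x => if x ∈ U then u x else _) (mem_univ i), if_pos hi]
          linarith [hu i S]
  | mix p π π' ih ih' =>
    rintro U c ⟨h, h'⟩ hc hb
    have h1 := mul_le_mul_of_nonneg_left (ih U c h hc (hb.imp_left And.left)) p.2.1
    have h2 := mul_le_mul_of_nonneg_left (ih' U c h' hc (hb.imp_left And.right))
      (sub_nonneg.2 p.2.2)
    simp only [expectedFrom]
    linarith

theorem expectedMatches_le_of_boundsMarginal {I : Fin a → ChoiceModel b}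
    {R : Fin b → ChoiceModel a} (hR : MonotoneSubmodularDemands R)
    {G : Fin b → Finset (Fin a)} {u : Fin a → ℝ} (hu : ∀ i, BoundsMarginal I R G i (u i))
    {π : Policy a b α} (hπ : π.OneSidedAdaptive)
    (hb : π.BacklogOnly ∨ ∀ j, (R j).WeaklySubstitutable) :
    π.expectedMatches I R ≤ ∑ j, (R j).demand (G j) + ∑ i, u i := by
  simpa [expectedMatches] using expectedFrom_le_of_boundsMarginal hR hu π univ (fun _ => none) hπ
    (fun _ _ => rfl) (by rwa [backlog_none])

/-! ## Lower bound for greedy policies -/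

theorem GreedyFrom.processesInTurn {I : Fin a → ChoiceModel b} {R : Fin b → ChoiceModel a}
    {π : Policy a b α} : ∀ {l : List (Fin a)} {V : Finset (Fin b)} {B : Fin b → Finset (Fin a)},
      l.Nodup → π.GreedyFrom I R l V B → π.ProcessesInTurn l.toFinset V := by
  induction π with
  | done x =>
    rintro l V B - ⟨rfl, rfl⟩
    exact ⟨rfl, rfl⟩
  | initiate i S next ih =>
    rintro l V B hl ⟨hi, -, h⟩
    cases l with
    | nil => simp at hi
    | cons i' l =>
      obtain rfl : i' = i := by simpa using hi
      rw [List.nodup_cons] at hl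
      refine ⟨by simp, fun o ho => ?_⟩
      rw [List.toFinset_cons, erase_insert (by simpa using hl.1)]
      exact ih o hl.2 (h o ho)
  | respond j C next ih =>
    rintro l V B hl ⟨rfl, hj, -, h⟩
    exact ⟨rfl, hj, fun o ho => ih o hl (h o ho)⟩
  | mix p π π' ih ih' =>
    rintro l V B hl ⟨h, h'⟩
    exact ⟨ih hl h, ih' hl h'⟩

theorem GreedyFrom.respectsBacklogs {I : Fin a → ChoiceModel b} {R : Fin b → ChoiceModel a}
    {π : Policy a b α} : ∀ {l : List (Fin a)} {V : Finset (Fin b)} {B : Fin b → Finset (Fin a)},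
      π.GreedyFrom I R l V B → π.RespectsBacklogs B := by
  induction π with
  | done x => exact fun _ => trivial
  | initiate i S next ih => exact fun h o ho => ih o (h.2.2 o ho)
  | respond j C next ih => exact fun h => ⟨h.2.2.1.subset, fun o ho => ih o (h.2.2.2 o ho)⟩
  | mix p π π' ih ih' => exact fun h => ⟨ih h.1, ih' h.2⟩

/-- Showing exactly the backlog turns the inequality of `expectedFrom_respond_le` into an equality.
-/
theorem GreedyFrom.expectedFrom_respond {I : Fin a → ChoiceModel b} {R : Fin b → ChoiceModel a}
    {c : Fin a → Option (Fin b)} {π : Policy a b α} :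
    ∀ {V : Finset (Fin b)} {d : Fin b → Option (Fin a)}, π.GreedyFrom I R [] V (backlog c) →
      (∀ j ∈ V, d j = none) →
      π.expectedFrom I R c d = matchCount c d + ∑ j ∈ V, (R j).demand (backlog c j) := by
  induction π with
  | done x =>
    rintro V d ⟨-, rfl⟩ -
    simp [expectedFrom]
  | initiate i S next ih =>
    rintro V d ⟨h, -⟩
    simp at h
  | respond j C next ih =>
    rintro V d ⟨-, hj, rfl, h⟩ hd
    have h1 : ∀ o ∈ insertNone (backlog c j),
        (next o).expectedFrom I R c (Function.update d j o) =
          matchCount c (Function.update d j o) +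
            ∑ j ∈ V.erase j, (R j).demand (backlog c j) := by
      refine fun o ho => ih o (h o ho) fun j' hj' => ?_
      rw [Function.update_of_ne (ne_of_mem_erase hj')]
      exact hd j' (mem_of_mem_erase hj')
    rw [expectedFrom, sum_congr rfl fun o ho => by rw [h1 o ho], ChoiceModel.sum_prob_mul_add,
      sum_prob_mul_matchCount _ _ (hd j hj), inter_self, ← add_sum_erase V _ hj, add_assoc]
    rfl
  | mix p π π' ih ih' =>
    rintro V d ⟨h, h'⟩ hd
    rw [expectedFrom, ih h hd, ih' h' hd]
    ring

/-- `X` is compared with a greedy policy by charging it to the final backlogs and to the greedy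
increments. -/
theorem GreedyFrom.add_sum_demand_le {I : Fin a → ChoiceModel b} {R : Fin b → ChoiceModel a}
    (hR : MonotoneSubmodularDemands R) {X : ℝ}
    (hX : ∀ (G : Fin b → Finset (Fin a)) (u : Fin a → ℝ),
      (∀ i, BoundsMarginal I R G i (u i)) → X ≤ ∑ j, (R j).demand (G j) + ∑ i, u i)
    {π : Policy a b α} :
    ∀ {l : List (Fin a)} {c : Fin a → Option (Fin b)} {u : Fin a → ℝ},
      π.GreedyFrom I R l univ (backlog c) → l.Nodup → (∀ i ∈ l, c i = none) →
      (∀ i, i ∉ l → BoundsMarginal I R (backlog c) i (u i)) →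
      X + ∑ j, (R j).demand (backlog c j) ≤
        2 * π.expectedFrom I R c (fun _ => none) + ∑ i, if i ∈ l then 0 else u i := by
  -- All initiating agents are processed, so the backlogs are final and `hX` applies to them. Their
  -- total demand is the expected number of matches still to come, which accounts for the factor
  -- two.
  have key : ∀ {π : Policy a b α} {c : Fin a → Option (Fin b)} {u : Fin a → ℝ},
      π.GreedyFrom I R [] univ (backlog c) →
      (∀ i, i ∉ ([] : List (Fin a)) → BoundsMarginal I R (backlog c) i (u i)) →
      X + ∑ j, (R j).demand (backlog c j) ≤ 2 * π.expectedFrom I R c (fun _ => none) +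
        ∑ i, if i ∈ ([] : List (Fin a)) then 0 else u i := by
    intro π c u hπ hu
    have h := hX (backlog c) u fun i => hu i (by simp)
    rw [hπ.expectedFrom_respond fun _ _ => rfl, matchCount_none]
    simp
    linarith
  induction π with
  | done x =>
    intro l c u hπ _ _ hu
    obtain rfl := hπ.1
    exact key hπ hu
  | respond j C next ih =>
    intro l c u hπ _ _ hu
    obtain rfl := hπ.1
    exact key hπ hu
  | initiate i S next ih =>
    rintro l c u ⟨hi, hS, h⟩ hl hc hu
    cases l with
    | nil => simp at hi
    | cons i' l =>
      obtain rfl : i' = i := by simpa using hi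
      rw [List.nodup_cons] at hl
      have hci : c i' = none := hc i' (by simp)
      set v : ℝ := ∑ j ∈ S, marginal R (backlog c) i' j * (I i').prob (some j) S with hv
      set D : ℝ := ∑ j, (R j).demand (backlog c j) with hD
      set W : ℝ := ∑ x, if x ∈ i' :: l then 0 else u x with hW
      -- From here on `u i'` is set to `v`. The choice `o` raises the potential on the left by its
      -- marginal, whose mean is also `v`, so the two cancel on averaging over `o`.
      have h1 : ∀ o ∈ insertNone S, o.elim 0 (marginal R (backlog c) i') + (X + D) ≤
          2 * (next o).expectedFrom I R (Function.update c i' o) (fun _ => none) + (W + v) := by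
        intro o ho
        have ho' := h o ho
        rw [List.tail_cons, addToBacklog_backlog hci] at ho'
        have h2 := ih o (u := Function.update u i' v) ho' hl.2 (fun x hx => ?_) fun x hx => ?_
        · rw [← addToBacklog_backlog hci, sum_demand_addToBacklog] at h2
          have h3 : (∑ x, if x ∈ l then 0 else Function.update u i' v x) = W + v := by
            rw [hW, ← add_sum_erase univ _ (mem_univ i'),
              ← add_sum_erase univ (fun x => if x ∈ i' :: l then 0 else u x) (mem_univ i')]
            have : ∀ x ∈ univ.erase i', (if x ∈ l then 0 else Function.update u i' v x) =
                if x ∈ i' :: l then 0 else u x := by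
              intro x hx
              simp [ne_of_mem_erase hx]
            rw [sum_congr rfl this]
            simp [hl.1]
            ring
          rw [h3] at h2
          linarith
        · rw [Function.update_of_ne (by rintro rfl; exact hl.1 hx)]
          exact hc x (by simp [hx])
        · rw [← addToBacklog_backlog hci]
          -- It suffices to bound marginals at the backlogs before the choice. There `v` works for
          -- `i'` because `S` is optimal, and the earlier values work by assumption.
          refine BoundsMarginal.mono hR ?_ (subset_addToBacklog (backlog c) i' o)
          by_cases hxi : x = i'
          · subst hxi
            rw [Function.update_self]
            exact hS
          · rw [Function.update_of_ne hxi]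
            exact hu x (by simp [hxi, hx])
      have h2 := sum_le_sum fun o ho => mul_le_mul_of_nonneg_left (h1 o ho)
        ((I i').prob_nonneg o S)
      rw [ChoiceModel.sum_prob_mul_add, ChoiceModel.sum_prob_mul_elim,
        ChoiceModel.sum_prob_mul_add] at h2
      simp only [mul_left_comm _ (2 : ℝ), ← mul_sum] at h2
      rw [expectedFrom]
      linarith
  | mix p π π' ih ih' =>
    rintro l c u ⟨h, h'⟩ hl hc hu
    have h1 := mul_le_mul_of_nonneg_left (ih h hl hc hu) p.2.1
    have h2 := mul_le_mul_of_nonneg_left (ih' h' hl hc hu) (sub_nonneg.2 p.2.2)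
    simp only [expectedFrom]
    linarith

/-! ### The approximation guarantee -/

theorem IsArbitraryOrderGreedy.expectedMatches_le {β : Type} {I : Fin a → ChoiceModel b}
    {R : Fin b → ChoiceModel a} (hR : MonotoneSubmodularDemands R) {σ : Equiv.Perm (Fin a)}
    {π : Policy a b α} (hπ : π.IsArbitraryOrderGreedy I R σ) {π' : Policy a b β}
    (hπ' : π'.OneSidedAdaptive) (hb : π'.BacklogOnly ∨ ∀ j, (R j).WeaklySubstitutable) :
    1 / 2 * π'.expectedMatches I R ≤ π.expectedMatches I R := by
  have h := GreedyFrom.add_sum_demand_le hR (X := π'.expectedMatches I R)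
    (fun G u hu => expectedMatches_le_of_boundsMarginal hR hu hπ' hb)
    -- At the start every agent is in the list, so the values of `u` are irrelevant.
    (l := List.ofFn σ) (c := fun _ => none) (u := fun _ => 0) (by rwa [backlog_none])
    (List.nodup_ofFn.2 σ.injective) (fun _ _ => rfl)
    fun i hi => absurd (List.mem_ofFn.2 ⟨σ.symm i, by simp⟩) hi
  simp only [backlog_none, ChoiceModel.demand_empty] at h
  simp at h
  unfold expectedMatches at h ⊢
  linarith

theorem IsArbitraryOrderGreedy.halfApproximates {I : Fin a → ChoiceModel b}
    {R : Fin b → ChoiceModel a} (hR : MonotoneSubmodularDemands R) {σ : Equiv.Perm (Fin a)}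
    {π : Policy a b α} (hπ : π.IsArbitraryOrderGreedy I R σ) : π.HalfApproximates I R := by
  obtain ⟨π₀, h₀, h₀'⟩ := exists_backlogOnly a b
  refine ⟨?_, GreedyFrom.respectsBacklogs hπ, ?_, fun hw => ?_⟩
  · have h := GreedyFrom.processesInTurn (List.nodup_ofFn.2 σ.injective) hπ
    rwa [show (List.ofFn σ).toFinset = univ from
      eq_univ_of_forall fun i => by simpa using ⟨σ.symm i, by simp⟩] at h
  · suffices h : optBacklogOA I R ≤ 2 * π.expectedMatches I R by linarith
    refine csSup_le ⟨_, π₀, h₀, h₀', rfl⟩ ?_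
    rintro _ ⟨π', h, h', rfl⟩
    linarith [hπ.expectedMatches_le hR h (.inl h')]
  · suffices h : optOA I R ≤ 2 * π.expectedMatches I R by linarith
    refine csSup_le ⟨_, π₀, h₀, rfl⟩ ?_
    rintro _ ⟨π', h, rfl⟩
    linarith [hπ.expectedMatches_le hR h (.inr hw)]

end Policy

end HalfApproximation

end TwoSided

namespace TwoSided

section RunningTime

variable {a b : ℕ} {α β : Type}

/-! ## Reasoning about executions -/

/-- The policy terminates without displaying anything, with an output satisfying `Q`. -/
def Policy.Computes (π : Policy a b α) (Q : α → Prop) : Prop := ∃ x, π = .done x ∧ Q x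

theorem Policy.Computes.mono {π : Policy a b α} {Q Q' : α → Prop} (h : π.Computes Q)
    (hQ : ∀ x, Q x → Q' x) : π.Computes Q' :=
  let ⟨x, hx, hq⟩ := h
  ⟨x, hx, hQ x hq⟩

theorem Policy.Computes.bind {π : Policy a b α} {f : α → Policy a b β} {Q : α → Prop}
    {Q' : β → Prop} (h : π.Computes Q) (hf : ∀ x, Q x → (f x).Computes Q') :
    (π.bind f).Computes Q' := by
  obtain ⟨x, rfl, hx⟩ := h
  exact hf x hx

theorem computes_iterate {body : ℕ → Store → Policy a b Store} {N : ℕ} {s : Store}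
    (Inv : ℕ → Store → Prop) (h0 : Inv 0 s)
    (h : ∀ t < N, ∀ s, Inv t s → (body t s).Computes (Inv (t + 1))) :
    (iterate body N s).Computes (Inv N) := by
  induction N with
  | zero => exact ⟨s, rfl, h0⟩
  | succ N ih => exact (ih fun t ht => h t (ht.trans N.lt_succ_self)).bind (h N N.lt_succ_self)

/-- The policy behaves greedily until its end, and there the output, the list of the initiating
agents and the set of the responding agents that are still to be processed, and the backlogs
satisfy `Q`. -/
def Policy.GreedyUntil (I : Fin a → ChoiceModel b) (R : Fin b → ChoiceModel a)
    (Q : α → List (Fin a) → Finset (Fin b) → (Fin b → Finset (Fin a)) → Prop) :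
    Policy a b α → List (Fin a) → Finset (Fin b) → (Fin b → Finset (Fin a)) → Prop
  | .done x, l, V, B => Q x l V B
  | .initiate i S next, l, V, B =>
      l.head? = some i ∧ IsOptimalAssortment (I i) (marginal R B i) S ∧
        ∀ o ∈ insertNone S, (next o).GreedyUntil I R Q l.tail V (addToBacklog B i o)
  | .respond j C next, l, V, B =>
      l = [] ∧ j ∈ V ∧ C = B j ∧
        ∀ o ∈ insertNone C, (next o).GreedyUntil I R Q l (V.erase j) B
  | .mix _ π π', l, V, B => π.GreedyUntil I R Q l V B ∧ π'.GreedyUntil I R Q l V B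

namespace Policy

variable {I : Fin a → ChoiceModel b} {R : Fin b → ChoiceModel a}

theorem GreedyUntil.mono
    {Q Q' : α → List (Fin a) → Finset (Fin b) → (Fin b → Finset (Fin a)) → Prop}
    (hQ : ∀ x l V B, Q x l V B → Q' x l V B) {π : Policy a b α} :
    ∀ {l V B}, π.GreedyUntil I R Q l V B → π.GreedyUntil I R Q' l V B := by
  induction π with
  | done x => exact fun h => hQ _ _ _ _ h
  | initiate i S next ih => exact fun h => ⟨h.1, h.2.1, fun o ho => ih o (h.2.2 o ho)⟩
  | respond j C next ih => exact fun h => ⟨h.1, h.2.1, h.2.2.1, fun o ho => ih o (h.2.2.2 o ho)⟩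
  | mix p π π' ih ih' => exact fun h => ⟨ih h.1, ih' h.2⟩

/-- The sequencing rule. The postcondition must record the remaining agents and the backlogs, as the
greediness of the continuation depends on them. -/
theorem GreedyUntil.bind
    {Q : α → List (Fin a) → Finset (Fin b) → (Fin b → Finset (Fin a)) → Prop}
    {Q' : β → List (Fin a) → Finset (Fin b) → (Fin b → Finset (Fin a)) → Prop}
    {f : α → Policy a b β} (hf : ∀ x l V B, Q x l V B → (f x).GreedyUntil I R Q' l V B)
    {π : Policy a b α} :
    ∀ {l V B}, π.GreedyUntil I R Q l V B → (π.bind f).GreedyUntil I R Q' l V B := by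
  induction π with
  | done x => exact fun h => hf _ _ _ _ h
  | initiate i S next ih => exact fun h => ⟨h.1, h.2.1, fun o ho => ih o (h.2.2 o ho)⟩
  | respond j C next ih => exact fun h => ⟨h.1, h.2.1, h.2.2.1, fun o ho => ih o (h.2.2.2 o ho)⟩
  | mix p π π' ih ih' => exact fun h => ⟨ih h.1, ih' h.2⟩

theorem GreedyUntil.greedyFrom
    {Q : α → List (Fin a) → Finset (Fin b) → (Fin b → Finset (Fin a)) → Prop}
    (hQ : ∀ x l V B, Q x l V B → l = [] ∧ V = ∅) {π : Policy a b α} :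
    ∀ {l V B}, π.GreedyUntil I R Q l V B → π.GreedyFrom I R l V B := by
  induction π with
  | done x => exact fun h => hQ _ _ _ _ h
  | initiate i S next ih => exact fun h => ⟨h.1, h.2.1, fun o ho => ih o (h.2.2 o ho)⟩
  | respond j C next ih => exact fun h => ⟨h.1, h.2.1, h.2.2.1, fun o ho => ih o (h.2.2.2 o ho)⟩
  | mix p π π' ih ih' => exact fun h => ⟨ih h.1, ih' h.2⟩

theorem GreedyUntil.always
    {Q : α → List (Fin a) → Finset (Fin b) → (Fin b → Finset (Fin a)) → Prop} {P : α → Prop}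
    (hQ : ∀ x l V B, Q x l V B → P x) {π : Policy a b α} :
    ∀ {l V B}, π.GreedyUntil I R Q l V B → π.Always P := by
  induction π with
  | done x => exact fun h => hQ _ _ _ _ h
  | initiate i S next ih => exact fun h o ho => ih o (h.2.2 o ho)
  | respond j C next ih => exact fun h o ho => ih o (h.2.2.2 o ho)
  | mix p π π' ih ih' => exact fun h => ⟨ih h.1, ih' h.2⟩

theorem Computes.greedyUntil_bind {Q : α → Prop}
    {Q' : β → List (Fin a) → Finset (Fin b) → (Fin b → Finset (Fin a)) → Prop}
    {f : α → Policy a b β} {π : Policy a b α} {l : List (Fin a)} {V : Finset (Fin b)}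
    {B : Fin b → Finset (Fin a)} (h : π.Computes Q)
    (hf : ∀ x, Q x → (f x).GreedyUntil I R Q' l V B) :
    (π.bind f).GreedyUntil I R Q' l V B := by
  obtain ⟨x, rfl, hx⟩ := h
  exact hf x hx

theorem greedyUntil_iterate {body : ℕ → Store → Policy a b Store} {N : ℕ} {s : Store}
    {l : List (Fin a)} {V : Finset (Fin b)} {B : Fin b → Finset (Fin a)}
    (Inv : ℕ → Store → List (Fin a) → Finset (Fin b) → (Fin b → Finset (Fin a)) → Prop)
    (h0 : Inv 0 s l V B)
    (h : ∀ t < N, ∀ s l V B, Inv t s l V B → (body t s).GreedyUntil I R (Inv (t + 1)) l V B) :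
    (iterate body N s).GreedyUntil I R (Inv N) l V B := by
  induction N with
  | zero => exact h0
  | succ N ih =>
    exact (ih fun t ht => h t (ht.trans N.lt_succ_self)).bind (h N N.lt_succ_self)

end Policy

/-! ## The program

Variables: `0`, `1` hold the numbers of agents, `2` is the position in the order, `3` the current
initiating agent, `4` the last observed choice, `5` and `6` run through the responding and through
the initiating agents.  Row `j` of array `1` holds the backlog of `j`, row `0` of array `2` the
assortment that is displayed.  The real array `1` holds the weights, the real array `0` the result
of the last look-up. -/

/-- The signed update of the weight of the agent in variable `5` by the last look-up. -/
def accumulateExpr : Bool → RealExpr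
  | true => .add (.entry 1 (.var 5)) (.entry 0 (.lit 0))
  | false => .sub (.entry 1 (.var 5)) (.entry 0 (.lit 0))

/-- Add the demand of the agent in variable `5` for its row in array `1` to its weight, or subtract
it. -/
def demandProgram (positive : Bool) : Program :=
  .loop 6 (.var 0) (.seq
    (.lookup (.var 5) (.add (.var 6) (.lit 1)) 1 (.var 5) 0 (.lit 0))
    (.setReal 1 (.var 5) (accumulateExpr positive)))

/-- Compute the marginal demand of the agent in variable `5` for the agent in variable `3`. -/
def marginalProgram : Program :=
  -- The language has no real constants, so zero is produced as a difference.
  .seq (.setReal 1 (.var 5) (.sub (.entry 1 (.var 5)) (.entry 1 (.var 5)))) (.seq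
    (.setEntry 1 (.var 5) (.var 3) (.lit 1)) (.seq
    (demandProgram true) (.seq
    (.setEntry 1 (.var 5) (.var 3) (.lit 0))
    (demandProgram false))))

/-- Process one initiating agent. -/
def initiateProgram : Program :=
  .seq (.setVar 3 (.entry 0 (.lit 0) (.var 2))) (.seq
    (.loop 5 (.var 1) marginalProgram) (.seq
    (.optimize (.var 3) 1 2 (.lit 0)) (.seq
    (.initiate (.var 3) 2 (.lit 0) 4)
    (.ifNonzero (.var 4) (.setEntry 1 (.sub (.var 4) (.lit 1)) (.var 3) (.lit 1)) .skip))))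

/-- Arbitrary Order Greedy. -/
def greedyProgram : Program :=
  .seq (.loop 2 (.var 0) initiateProgram) (.loop 5 (.var 1) (.respond (.var 5) 1 (.var 5) 4))

/-- `1` or `-1`. -/
def signOf (positive : Bool) : ℝ := if positive then 1 else -1

theorem eval_accumulateExpr (positive : Bool) (s : Store) :
    (accumulateExpr positive).eval s = s.real 1 (s.var 5) + signOf positive * s.real 0 0 := by
  cases positive <;> simp [accumulateExpr, RealExpr.eval, NatExpr.eval, signOf, sub_eq_add_neg]

theorem cost_accumulateExpr (positive : Bool) : (accumulateExpr positive).cost = 5 := by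
  cases positive <;> rfl

/-- `s'` differs from `s` only in variables `5`, `6` and in the real arrays, apart from the time. -/
structure SameData (s s' : Store) : Prop where
  var : ∀ x, x ≠ 5 → x ≠ 6 → s'.var x = s.var x
  entry : s'.entry = s.entry

/-- Agents outside `S` have probability zero, so a loop over all agents computes the demand without
membership tests. The shift skips code `0`, the outside option. -/
theorem sum_range_atChoice {k : ℕ} (φ : ChoiceModel k) (S : Finset (Fin k)) :
    ∑ t ∈ range k, atChoice (fun o => φ.prob o S) (t + 1) = φ.demand S := by
  rw [φ.demand_eq_sum_univ, ← Fin.sum_univ_eq_sum_range]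
  exact sum_congr rfl fun i _ => by simp [atChoice]

namespace Program

variable {R : Fin b → ChoiceModel a} {O : Oracle a b} {τ : ℕ}

theorem exec_seq_of_done {P Q : Program} {s s' : Store} (h : P.exec R O τ s = .done s') :
    (seq P Q).exec R O τ s = Q.exec R O τ s' := by
  rw [exec, h, Policy.bind]

/-- Resolves the run-time bounds check once the index is known to be an agent; the next three lemmas
do the same for their instructions. -/
theorem exec_lookup_of_eq {j o row pos : NatExpr} {k t : ℕ} {s : Store} {l : Fin b}
    (h : j.eval s = l) :
    (lookup j o k row t pos).exec R O τ s =
      .done ((s.tick (j.cost + o.cost + row.cost + pos.cost + a + b + τ + 1)).setReal t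
        (pos.eval s) (atChoice (fun c => (R l).prob c (s.rowSet a k (row.eval s)))
          (o.eval s))) := by
  have h' : (⟨j.eval s, h ▸ l.2⟩ : Fin b) = l := Fin.ext h
  rw [exec, dif_pos (h ▸ l.2), h']

theorem exec_optimize_of_eq {i row : NatExpr} {t k : ℕ} {s : Store} {l : Fin a}
    (h : i.eval s = l) :
    (optimize i t k row).exec R O τ s =
      .done ((s.tick (i.cost + row.cost + a + b + τ + 1)).setRow k (row.eval s)
        (encodeSet (O l fun j => s.real t j))) := by
  have h' : (⟨i.eval s, h ▸ l.2⟩ : Fin a) = l := Fin.ext h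
  rw [exec, dif_pos (h ▸ l.2), h']

theorem exec_initiate_of_eq {i row : NatExpr} {k x : ℕ} {s : Store} {l : Fin a}
    (h : i.eval s = l) :
    (initiate i k row x).exec R O τ s =
      .initiate l (s.rowSet b k (row.eval s)) fun c =>
        .done ((s.tick (i.cost + row.cost + a + b + 1)).setVar x (encodeChoice c)) := by
  have h' : (⟨i.eval s, h ▸ l.2⟩ : Fin a) = l := Fin.ext h
  rw [exec, dif_pos (h ▸ l.2), h']

theorem exec_respond_of_eq {j row : NatExpr} {k x : ℕ} {s : Store} {l : Fin b}
    (h : j.eval s = l) :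
    (respond j k row x).exec R O τ s =
      .respond l (s.rowSet a k (row.eval s)) fun c =>
        .done ((s.tick (j.cost + row.cost + a + b + 1)).setVar x (encodeChoice c)) := by
  have h' : (⟨j.eval s, h ▸ l.2⟩ : Fin b) = l := Fin.ext h
  rw [exec, dif_pos (h ▸ l.2), h']

end Program

/-! ### Memory effects and step counts of the subroutines -/

theorem rowSet_encodeSet (s : Store) (k r : ℕ) (A : Finset (Fin b)) :
    (s.setRow k r (encodeSet A)).rowSet b k r = A := by
  ext x
  simp [Store.rowSet, Store.setRow, encodeSet]

theorem rowSet_setEntry_one (s : Store) (k r : ℕ) (i : Fin a) :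
    (s.setEntry k r i 1).rowSet a k r = insert i (s.rowSet a k r) := by
  ext x
  by_cases h : x = i
  · simp [Store.rowSet, Store.setEntry, Store.setRow, h]
  · simp [Store.rowSet, Store.setEntry, Store.setRow, h, Fin.val_inj]

theorem rowSet_setEntry_zero (s : Store) (k r : ℕ) (i : Fin a) :
    (s.setEntry k r i 0).rowSet a k r = (s.rowSet a k r).erase i := by
  ext x
  by_cases h : x = i
  · simp [Store.rowSet, Store.setEntry, Store.setRow, h]
  · simp [Store.rowSet, Store.setEntry, Store.setRow, h, Fin.val_inj]

theorem rowSet_setEntry_of_ne (s : Store) (k c v : ℕ) {r r' : ℕ} (h : r' ≠ r) :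
    (s.setEntry k r c v).rowSet a k r' = s.rowSet a k r' := by
  simp [Store.rowSet, Store.setEntry, Store.setRow, h]

/-- The invariant is a partial sum of choice probabilities. In each round the loop counter costs
`1`, the look-up `a + b + τ + 7` and the update `7`. -/
theorem demandProgram_computes (R : Fin b → ChoiceModel a) (O : Oracle a b) (τ : ℕ)
    (positive : Bool) (s : Store) (h0 : s.var 0 = a) (j : Fin b) (h5 : s.var 5 = j) :
    ((demandProgram positive).exec R O τ s).Computes fun s' =>
      SameData s s' ∧ s'.var 5 = j ∧ (∀ x, x ≠ (j : ℕ) → s'.real 1 x = s.real 1 x) ∧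
      s'.real 1 j = s.real 1 j + signOf positive * (R j).demand (s.rowSet a 1 j) ∧
      s'.time = s.time + a * (a + b + τ + 15) + 2 := by
  rw [demandProgram, Program.exec]
  simp only [NatExpr.eval, h0]
  have h := computes_iterate (a := a) (b := b) (N := a)
    (body := fun t s' => (Program.seq
      (.lookup (.var 5) (.add (.var 6) (.lit 1)) 1 (.var 5) 0 (.lit 0))
      (.setReal 1 (.var 5) (accumulateExpr positive))).exec R O τ ((s'.setVar 6 t).tick 1))
    (s := s.tick ((NatExpr.var 0).cost + 1))
    (fun t s' => SameData s s' ∧ s'.var 5 = j ∧ (∀ x, x ≠ (j : ℕ) → s'.real 1 x = s.real 1 x) ∧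
      s'.real 1 j = s.real 1 j + signOf positive *
        ∑ i ∈ range t, atChoice (fun o => (R j).prob o (s.rowSet a 1 j)) (i + 1) ∧
      s'.time = s.time + t * (a + b + τ + 15) + 2)
    ⟨⟨fun _ _ _ => rfl, rfl⟩, h5, fun _ _ => rfl, by simp [Store.tick],
      by simp [Store.tick, NatExpr.cost]⟩ ?_
  · simpa only [sum_range_atChoice] using h
  · rintro t - s' ⟨hs, h5', hr, hj, ht⟩
    have e : (NatExpr.var 5).eval ((s'.setVar 6 t).tick 1) = j := h5'
    rw [Program.exec_seq_of_done (Program.exec_lookup_of_eq e)]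
    refine ⟨_, rfl, ⟨fun x hx hx' => ?_, hs.entry⟩, h5', fun x hx => ?_, ?_, ?_⟩
    · simp [Store.setReal, Store.setVar, Store.tick, hx', hs.var x hx]
    · simp [Store.setReal, Store.setVar, Store.tick, NatExpr.eval, h5', hx, hr]
    · simp [Store.setReal, Store.setVar, Store.tick, NatExpr.eval, h5', eval_accumulateExpr,
        sum_range_succ, hj, Store.rowSet, hs.entry]
      ring
    · simp only [Store.setReal, Store.setVar, Store.tick, NatExpr.cost, cost_accumulateExpr, ht]
      ring

theorem marginalProgram_computes (R : Fin b → ChoiceModel a) (O : Oracle a b) (τ : ℕ)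
    (s : Store) (h0 : s.var 0 = a) (i : Fin a) (h3 : s.var 3 = i) (j : Fin b) (h5 : s.var 5 = j)
    (hi : i ∉ s.rowSet a 1 j) :
    (marginalProgram.exec R O τ s).Computes fun s' =>
      SameData s s' ∧ (∀ x, x ≠ (j : ℕ) → s'.real 1 x = s.real 1 x) ∧
      s'.real 1 j = (R j).demand (insert i (s.rowSet a 1 j)) - (R j).demand (s.rowSet a 1 j) ∧
      s'.time = s.time + 2 * (a * (a + b + τ + 15)) + 19 := by
  -- The entry is literally `0` beforehand, so writing `1` and then `0` restores the array exactly.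
  have hi' : s.entry 1 j i = 0 := by simpa [Store.rowSet] using hi
  have e₁ : (Program.setReal 1 (.var 5)
      (.sub (.entry 1 (.var 5)) (.entry 1 (.var 5)))).exec R O τ s =
      .done ((s.setReal 1 j 0).tick 7) := by
    simp [Program.exec, NatExpr.eval, RealExpr.eval, NatExpr.cost, RealExpr.cost, h5]
  have e₂ : (Program.setEntry 1 (.var 5) (.var 3) (.lit 1)).exec R O τ
      ((s.setReal 1 j 0).tick 7) =
      .done ((((s.setReal 1 j 0).tick 7).setEntry 1 j i 1).tick 4) := by
    simp [Program.exec, NatExpr.eval, NatExpr.cost, Store.tick, Store.setReal, h5, h3]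
  rw [marginalProgram, Program.exec_seq_of_done e₁, Program.exec_seq_of_done e₂, Program.exec]
  have hd := demandProgram_computes R O τ true
    ((((s.setReal 1 j 0).tick 7).setEntry 1 j i 1).tick 4) h0 j h5
  refine hd.bind ?_
  rintro s₁ ⟨hs₁, h5₁, hr₁, hj₁, ht₁⟩
  have h3₁ : s₁.var 3 = i := (hs₁.var 3 (by decide) (by decide)).trans h3
  have h0₁ : s₁.var 0 = a := (hs₁.var 0 (by decide) (by decide)).trans h0
  have e₃ : (Program.setEntry 1 (.var 5) (.var 3) (.lit 0)).exec R O τ s₁ =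
      .done ((s₁.setEntry 1 j i 0).tick 4) := by
    simp [Program.exec, NatExpr.eval, NatExpr.cost, h5₁, h3₁]
  rw [Program.exec_seq_of_done e₃]
  have hd' := demandProgram_computes R O τ false ((s₁.setEntry 1 j i 0).tick 4) h0₁ j h5₁
  refine hd'.mono ?_
  rintro s₂ ⟨hs₂, -, hr₂, hj₂, ht₂⟩
  have hrow₁ : ((((s.setReal 1 j 0).tick 7).setEntry 1 j i 1).tick 4).rowSet a 1 j =
      insert i (s.rowSet a 1 j) := rowSet_setEntry_one s 1 j i
  have hrow₂ : ((s₁.setEntry 1 j i 0).tick 4).rowSet a 1 j = s.rowSet a 1 j := by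
    refine (rowSet_setEntry_zero s₁ 1 j i).trans ?_
    rw [show s₁.rowSet a 1 j = insert i (s.rowSet a 1 j) by
      rw [← hrow₁]; simp only [Store.rowSet, hs₁.entry], erase_insert hi]
  refine ⟨⟨fun x hx hx' => (hs₂.var x hx hx').trans (hs₁.var x hx hx'), ?_⟩, fun x hx => ?_,
    ?_, ?_⟩
  · rw [hs₂.entry]
    simp only [Store.tick, Store.setEntry, Store.setRow, hs₁.entry, Store.setReal]
    funext k r c
    by_cases hk : k = 1
    · subst hk
      by_cases hr : r = j
      · subst hr
        by_cases hc : c = i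
        · subst hc; simp [hi']
        · simp [hc]
      · simp [hr]
    · simp [hk]
  · rw [hr₂ x hx]
    refine (hr₁ x hx).trans ?_
    simp [Store.setEntry, Store.setRow, Store.setReal, Store.tick, hx]
  · have h : s₁.real 1 j = 0 + signOf true * (R j).demand (insert i (s.rowSet a 1 j)) := by
      rw [hj₁, hrow₁]
      simp [Store.setEntry, Store.setRow, Store.setReal, Store.tick]
    rw [hj₂, hrow₂]
    refine (congrArg (· + _) h).trans ?_
    simp [signOf, sub_eq_add_neg]
  · rw [ht₂]
    simp only [Store.setEntry, Store.setRow, Store.tick, ht₁, Store.setReal]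
    ring

theorem marginalLoop_computes (R : Fin b → ChoiceModel a) (O : Oracle a b) (τ : ℕ)
    (s : Store) (h0 : s.var 0 = a) (h1 : s.var 1 = b) (i : Fin a) (h3 : s.var 3 = i)
    (hi : ∀ j : Fin b, i ∉ s.rowSet a 1 j) :
    ((Program.loop 5 (.var 1) marginalProgram).exec R O τ s).Computes fun s' =>
      SameData s s' ∧ (∀ j : Fin b, s'.real 1 j = marginal R (fun j => s.rowSet a 1 j) i j) ∧
      s'.time = s.time + b * (2 * (a * (a + b + τ + 15)) + 20) + 2 := by
  rw [Program.exec]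
  simp only [NatExpr.eval, h1]
  have h := computes_iterate (a := a) (b := b) (N := b)
    (body := fun t s' => marginalProgram.exec R O τ ((s'.setVar 5 t).tick 1))
    (s := s.tick ((NatExpr.var 1).cost + 1)) (fun t s' => SameData s s' ∧
    (∀ j : Fin b, (j : ℕ) < t → s'.real 1 j = marginal R (fun j => s.rowSet a 1 j) i j) ∧
      s'.time = s.time + t * (2 * (a * (a + b + τ + 15)) + 20) + 2)
    ⟨⟨fun _ _ _ => rfl, rfl⟩, by simp, by simp [Store.tick, NatExpr.cost]⟩ ?_
  · exact h.mono fun s' h => ⟨h.1, fun j => h.2.1 j j.2, h.2.2⟩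
  rintro t htb s' ⟨hs, hr, ht⟩
  have hrow : ∀ r, ((s'.setVar 5 t).tick 1).rowSet a 1 r = s.rowSet a 1 r := fun r => by
    simp [Store.rowSet, Store.setVar, Store.tick, hs.entry]
  refine (marginalProgram_computes R O τ _ ?_ i ?_ ⟨t, htb⟩ rfl ?_).mono ?_
  · exact (hs.var 0 (by decide) (by decide)).trans h0
  · exact (hs.var 3 (by decide) (by decide)).trans h3
  · rw [hrow]
    exact hi ⟨t, htb⟩
  · rintro s'' ⟨hs', hr', hj', ht'⟩
    refine ⟨⟨fun x hx hx' => ?_, hs'.entry.trans hs.entry⟩, fun j hj => ?_, ?_⟩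
    · rw [hs'.var x hx hx', ← hs.var x hx hx']
      simp [Store.setVar, Store.tick, hx]
    · by_cases hjt : (j : ℕ) = t
      · obtain rfl : j = ⟨t, htb⟩ := Fin.ext hjt
        rw [hj', hrow, marginal]
      · rw [hr' j hjt]
        exact hr j (by omega)
    · rw [ht']
      simp only [Store.setVar, Store.tick, ht]
      ring

/-- The states between two iterations of the main loop. -/
structure InitiateInvariant (σ : Equiv.Perm (Fin a)) (τ t : ℕ) (s : Store) (l : List (Fin a))
    (V : Finset (Fin b)) (B : Fin b → Finset (Fin a)) : Prop where
  var_zero : s.var 0 = a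
  var_one : s.var 1 = b
  order : ∀ x : Fin a, s.entry 0 0 x = σ x
  rowSet : ∀ j : Fin b, s.rowSet a 1 j = B j
  list : l = (List.ofFn σ).drop t
  remaining : V = univ
  notMem : ∀ j, ∀ i ∈ B j, i ∉ l
  time : s.time ≤
    2 + t * (b * (2 * (a * (a + b + τ + 15)) + 20) + 2 * (a + b) + τ + 30)

/-- The field `notMem` of the invariant ensures that the current agent is in no backlog, as
`marginalProgram` requires when it inserts and removes that agent. Apart from the marginal loop's
rounds and the terms in `a + b` and `τ`, a round costs `21` steps after a choice and `16` after the
outside option; `30` covers both. -/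
theorem initiateProgram_greedyUntil {I : Fin a → ChoiceModel b} {R : Fin b → ChoiceModel a}
    (hR : MonotoneSubmodularDemands R) {O : Oracle a b} (hO : O.Correct I) (τ : ℕ)
    (σ : Equiv.Perm (Fin a)) {t : ℕ} (hta : t < a) {s : Store} {l : List (Fin a)}
    {V : Finset (Fin b)} {B : Fin b → Finset (Fin a)} (h : InitiateInvariant σ τ t s l V B) :
    (initiateProgram.exec R O τ ((s.setVar 2 t).tick 1)).GreedyUntil I R
      (InitiateInvariant σ τ (t + 1)) l V B := by
  obtain ⟨h0, h1, hσ, hrow, hl, hV, hB, ht⟩ := h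
  set i : Fin a := σ ⟨t, hta⟩ with hi
  have hl' : l = i :: (List.ofFn σ).drop (t + 1) := by
    rw [hl, List.drop_eq_getElem_cons (by simpa using hta)]
    simp [hi]
  have hnd : (i :: (List.ofFn σ).drop (t + 1)).Nodup := by
    rw [← hl', hl]
    exact (List.nodup_ofFn.2 σ.injective).sublist (List.drop_sublist _ _)
  rw [initiateProgram, Program.exec_seq_of_done rfl, Program.exec]
  simp only [NatExpr.eval, NatExpr.cost]
  have hσi : s.entry 0 0 t = i := hσ ⟨t, hta⟩
  refine (marginalLoop_computes R O τ _ ?_ ?_ i ?_ ?_).greedyUntil_bind ?_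
  · exact h0
  · exact h1
  · exact hσi
  · intro j hj
    refine hB j i ?_ (by simp [hl'])
    rw [← hrow]
    exact hj
  rintro s₁ ⟨hs₁, hr₁, ht₁⟩
  have hrow₁ : ∀ j : Fin b, s₁.rowSet a 1 j = B j := by
    intro j
    rw [← hrow]
    simp only [Store.rowSet, hs₁.entry]
    rfl
  have h3₁ : (NatExpr.var 3).eval s₁ = i := (hs₁.var 3 (by decide) (by decide)).trans hσi
  have hr₁' : (fun j : Fin b => s₁.real 1 j) = marginal R B i := by
    funext j
    rw [hr₁]
    simp only [marginal, ← hrow]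
    rfl
  have h3₂ : (NatExpr.var 3).eval
      ((s₁.tick ((NatExpr.var 3).cost + (NatExpr.lit 0).cost + a + b + τ + 1)).setRow 2
        ((NatExpr.lit 0).eval s₁) (encodeSet (O i fun j => s₁.real 1 j))) = i := h3₁
  rw [Program.exec_seq_of_done (Program.exec_optimize_of_eq h3₁), Program.exec,
    Program.exec_initiate_of_eq h3₂, Policy.bind]
  refine ⟨by simp [hl'], ?_, fun o ho => ?_⟩
  · simp only [NatExpr.eval]
    rw [rowSet_encodeSet, hr₁']
    -- The oracle is only trusted for nonnegative weights; monotonicity of the demands provides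
    -- them.
    exact hO i _ (marginal_nonneg hR B i)
  simp only [hr₁', Policy.bind]
  rw [Program.exec]
  have hB' : ∀ j, ∀ x ∈ addToBacklog B i o j, x ∉ l.tail := by
    intro j x hx
    rw [hl', List.tail_cons]
    unfold addToBacklog at hx
    have hxB : x ∈ B j → x ∉ (List.ofFn σ).drop (t + 1) := fun hxj hxl =>
      hB j x hxj (by rw [hl']; exact List.mem_cons_of_mem _ hxl)
    split_ifs at hx with hoj
    · rcases mem_insert.1 hx with rfl | hx
      · exact (List.nodup_cons.1 hnd).1
      · exact hxB hx
    · exact hxB hx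
  have htail : l.tail = (List.ofFn σ).drop (t + 1) := by rw [hl', List.tail_cons]
  have h0₁ : s₁.var 0 = a := (hs₁.var 0 (by decide) (by decide)).trans h0
  have h1₁ : s₁.var 1 = b := (hs₁.var 1 (by decide) (by decide)).trans h1
  have he₁ : s₁.entry = s.entry := hs₁.entry
  have hmul : (t + 1) * (b * (2 * (a * (a + b + τ + 15)) + 20) + 2 * (a + b) + τ + 30) =
      t * (b * (2 * (a * (a + b + τ + 15)) + 20) + 2 * (a + b) + τ + 30) +
        (b * (2 * (a * (a + b + τ + 15)) + 20) + 2 * (a + b) + τ + 30) := by ring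
  simp only [Store.setVar, Store.tick] at ht₁
  cases o with
  | none =>
    rw [if_neg (by simp [NatExpr.eval, Store.setVar, encodeChoice]), Program.exec]
    refine ⟨h0₁, h1₁, fun x => ?_, fun j => ?_, htail, hV, hB', ?_⟩
    · simp [Store.setVar, Store.tick, Store.setRow, he₁, hσ]
    · simpa [Store.rowSet, Store.setVar, Store.tick, Store.setRow, addToBacklog] using hrow₁ j
    · simp only [Store.setVar, Store.tick, Store.setRow, NatExpr.cost, ht₁, hmul]
      omega
  | some j₀ =>
    rw [if_pos (by simp [NatExpr.eval, Store.setVar, encodeChoice]), Program.exec]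
    refine ⟨h0₁, h1₁, fun x => ?_, fun j => ?_, htail, hV, hB', ?_⟩
    · simp [Store.setEntry, Store.setVar, Store.tick, Store.setRow, he₁, hσ]
    · have hrow₂ : j ≠ j₀ → (j : ℕ) ≠ j₀ := fun h h' => h (Fin.ext h')
      have h3₃ : s₁.var 3 = i := h3₁
      by_cases hj : j = j₀
      · subst hj
        rw [addToBacklog, if_pos rfl, ← hrow₁]
        simpa [Store.rowSet, Store.setEntry, Store.setVar, Store.tick, Store.setRow, NatExpr.eval,
          encodeChoice, h3₃] using rowSet_setEntry_one s₁ 1 j i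
      · rw [addToBacklog, if_neg (by simpa using Ne.symm hj), ← hrow₁]
        simpa [Store.rowSet, Store.setEntry, Store.setVar, Store.tick, Store.setRow, NatExpr.eval,
          encodeChoice, h3₃] using rowSet_setEntry_of_ne (a := a) s₁ 1 i 1 (hrow₂ hj)
    · simp only [Store.setEntry, Store.setVar, Store.tick, Store.setRow, NatExpr.cost, ht₁, hmul]
      omega

/-! ### The responding loop and the total running time -/

theorem respondLoop_greedyUntil {I : Fin a → ChoiceModel b} {R : Fin b → ChoiceModel a}
    (O : Oracle a b) (τ : ℕ) {s : Store} {B : Fin b → Finset (Fin a)} (h1 : s.var 1 = b)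
    (hrow : ∀ j : Fin b, s.rowSet a 1 j = B j) :
    ((Program.loop 5 (.var 1) (.respond (.var 5) 1 (.var 5) 4)).exec R O τ s).GreedyUntil I R
      (fun s' l V _ => (l = [] ∧ V = ∅) ∧ s'.time ≤ s.time + 2 + b * (a + b + 4)) [] univ B := by
  rw [Program.exec]
  simp only [NatExpr.eval, h1]
  -- Before round `t` exactly the agents with index at least `t` remain; backlogs and arrays no
  -- longer change.
  refine Policy.GreedyUntil.mono ?_ (Policy.greedyUntil_iterate (fun t s' l V B' =>
    l = [] ∧ V = univ.filter (fun j : Fin b => t ≤ (j : ℕ)) ∧ B' = B ∧ s'.entry = s.entry ∧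
      s'.time ≤ s.time + 2 + t * (a + b + 4)) ⟨rfl, by simp, rfl, rfl, ?_⟩ ?_)
  · rintro s' l V B' ⟨rfl, rfl, -, -, ht⟩
    exact ⟨⟨rfl, by ext j; simp⟩, ht⟩
  · simp [Store.tick, NatExpr.cost]
  · rintro t ht s' l V B' ⟨rfl, rfl, rfl, he, htime⟩
    have e : (NatExpr.var 5).eval ((s'.setVar 5 t).tick 1) = (⟨t, ht⟩ : Fin b) := rfl
    rw [Program.exec_respond_of_eq e]
    refine ⟨rfl, by simp, ?_, fun o ho => ⟨rfl, ?_, rfl, he, ?_⟩⟩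
    · rw [← hrow, e]
      simp [Store.rowSet, Store.setVar, Store.tick, he]
    · ext j
      simp only [mem_erase, mem_filter, mem_univ, true_and, ne_eq, Fin.ext_iff]
      omega
    · simp only [Store.setVar, Store.tick, NatExpr.cost, add_mul t 1]
      omega

/-- A bound for the running time, as a function of the numbers of agents plus the time of an
oracle call. -/
noncomputable def greedyTime : Polynomial ℕ :=
  4 + .X * (.X * (2 * (.X * (.X + 15)) + 20) + 2 * .X + .X + 30) + .X * (.X + 4)

theorem eval_greedyTime (x : ℕ) : greedyTime.eval x =
    4 + x * (x * (2 * (x * (x + 15)) + 20) + 2 * x + x + 30) + x * (x + 4) := by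
  simp [greedyTime]

theorem greedyProgram_greedyUntil {I : Fin a → ChoiceModel b} {R : Fin b → ChoiceModel a}
    (hR : MonotoneSubmodularDemands R) {O : Oracle a b} (hO : O.Correct I) (τ : ℕ)
    (σ : Equiv.Perm (Fin a)) :
    (greedyProgram.run R O τ σ).GreedyUntil I R
      (fun s l V _ => (l = [] ∧ V = ∅) ∧ s.time ≤ greedyTime.eval (a + b + τ)) (List.ofFn σ) univ
      fun _ => ∅ := by
  have hloop : ((Program.loop 2 (.var 0) initiateProgram).exec R O τ
      (initialStore b σ)).GreedyUntil I R (InitiateInvariant σ τ a) (List.ofFn σ) univ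
        fun _ => ∅ := by
    rw [Program.exec]
    refine Policy.greedyUntil_iterate (InitiateInvariant σ τ)
      ⟨rfl, rfl, fun x => ?_, fun j => ?_, rfl, rfl, by simp, ?_⟩
      fun t ht s l V B h => initiateProgram_greedyUntil hR hO τ σ ht h
    · simp [initialStore, Store.tick]
    · simp [initialStore, Store.tick, Store.rowSet]
    · simp [initialStore, Store.tick, NatExpr.cost]
  rw [Program.run, greedyProgram, Program.exec]
  refine Policy.GreedyUntil.bind ?_ hloop
  rintro s l V B ⟨-, h1, -, hrow, hl, rfl, -, ht⟩
  obtain rfl : l = [] := by simp [hl]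
  refine (respondLoop_greedyUntil O τ h1 hrow).mono ?_
  rintro s' l V B' ⟨hlV, ht'⟩
  refine ⟨hlV, ht'.trans ?_⟩
  rw [eval_greedyTime]
  calc s.time + 2 + b * (a + b + 4)
      ≤ 2 + a * (b * (2 * (a * (a + b + τ + 15)) + 20) + 2 * (a + b) + τ + 30) + 2 +
          b * (a + b + 4) := by gcongr
    _ = 4 + a * (b * (2 * (a * (a + b + τ + 15)) + 20) + 2 * (a + b) + τ + 30) +
          b * (a + b + 4) := by ring
    _ ≤ _ := by
        -- The bound is monotone in each of `a`, `b`, `a + b` and `τ`, and all of them are at most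
        -- `a + b + τ`.
        have hab : a + b ≤ a + b + τ := by omega
        have ha : a ≤ a + b + τ := by omega
        have hb : b ≤ a + b + τ := by omega
        have hτ : τ ≤ a + b + τ := by omega
        generalize a + b + τ = x at *
        gcongr

theorem greedyProgram_correct {I : Fin a → ChoiceModel b} {R : Fin b → ChoiceModel a}
    (hR : MonotoneSubmodularDemands R) {O : Oracle a b} (hO : O.Correct I) (τ : ℕ)
    (σ : Equiv.Perm (Fin a)) :
    (greedyProgram.run R O τ σ).IsArbitraryOrderGreedy I R σ ∧
      (greedyProgram.run R O τ σ).HalfApproximates I R ∧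
      (greedyProgram.run R O τ σ).Always fun s => s.time ≤ greedyTime.eval (a + b + τ) := by
  have h := greedyProgram_greedyUntil hR hO τ σ
  have hg : (greedyProgram.run R O τ σ).IsArbitraryOrderGreedy I R σ :=
    h.greedyFrom fun _ _ _ _ hQ => hQ.1
  exact ⟨hg, hg.halfApproximates hR, h.always fun _ _ _ _ hQ => hQ.2⟩

end RunningTime

end TwoSided

theorem theorem4 :
    ∃ (P : Program) (p : Polynomial ℕ), ∀ (n m : ℕ) (M : Market n m), M.MonotoneSubmodular →
      -- customers initiate
      ((∀ (σ : Equiv.Perm (Fin n)) (π : Policy n m Unit),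
          π.IsArbitraryOrderGreedy M.customer M.supplier σ →
            π.HalfApproximates M.customer M.supplier) ∧
        (∀ (σ : Equiv.Perm (Fin n)) (O : Oracle n m) (τ : ℕ), O.Correct M.customer →
          (P.run M.supplier O τ σ).IsArbitraryOrderGreedy M.customer M.supplier σ ∧
            (P.run M.supplier O τ σ).HalfApproximates M.customer M.supplier ∧
            (P.run M.supplier O τ σ).Always fun s => s.time ≤ p.eval (n + m + τ))) ∧
      -- suppliers initiate
      ((∀ (σ : Equiv.Perm (Fin m)) (π : Policy m n Unit),
          π.IsArbitraryOrderGreedy M.supplier M.customer σ →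
            π.HalfApproximates M.supplier M.customer) ∧
        (∀ (σ : Equiv.Perm (Fin m)) (O : Oracle m n) (τ : ℕ), O.Correct M.supplier →
          (P.run M.customer O τ σ).IsArbitraryOrderGreedy M.supplier M.customer σ ∧
            (P.run M.customer O τ σ).HalfApproximates M.supplier M.customer ∧
            (P.run M.customer O τ σ).Always fun s => s.time ≤ p.eval (n + m + τ))) := by
  refine ⟨greedyProgram, greedyTime, fun n m M hM => ⟨⟨fun σ π hπ => hπ.halfApproximates hM.2,
    fun σ O τ hO => greedyProgram_correct hM.2 hO τ σ⟩, fun σ π hπ => hπ.halfApproximates hM.1,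
    fun σ O τ hO => ?_⟩⟩
  rw [add_comm n m]
  exact greedyProgram_correct hM.1 hO τ σ
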